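/- Let $\Bbbk$ be an algebraically closed field of characteristic $p>0$, let $G$ be a finite elementary abelian $p$-group, $H=\Bbbk[G]$ its group algebra (a Hopf algebra), and $A=\Bbbk[x]/(x^p-x)$. Conventions. For a Hopf algebra $H$ and an algebra $A$, an $H$-cleft extension of $A$ is a right $H$-comodule algebra $B\supseteq A$ with $B^{\mathrm{co}\,H}=A$ for which there is a convolution invertible right $H$-comodule map $\gamma:H\to B$. Two $H$-cleft extensions $B,B'$ of $A$ are twist equivalent if there are an algebra automorphism $\varphi$ of $A$, a Hopf algebra automorphism $\phi$ of $H$ and an algebra isomorphism $f:B\to B'$ with $f(ab)=\varphi(a)f(b)$ for $a\in A$, $b\in B$, and $(\mathrm{id}\otimes\phi)\rho_{B'}(f(b))=(f\otimes \mathrm{id})\rho_B(b)$ for $b\in B$, where $\rho_B,\rho_{B'}$ are the coactions. For a finite-dimensional Hopf algebra $K$, the Heisenberg double $\mathcal H(K^*)$ is the smash product $K^*\# K$ for the action $(h\rightharpoonup f)(y)=f(yh)$, regarded as a $K$-cleft extension of $K^*$ via the coaction $f\# h\mapsto \sum (f\# h_1)\otimes h_2$. (a) Every $H$-cleft extension of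 $A$ is twist equivalent either to the tensor product algebra $A\otimes H$, or to $\mathcal H(\Bbbk[C]^*)\otimes \Bbbk[G']$ for some subgroups $C,G'$ of $G$ with $C\cong C_p$ and $C\oplus G'=G$. Here $\Bbbk[C]\otimes\Bbbk[G']$ is identified with $\Bbbk[G]$ in the natural way, and $A$ is identified with $\Bbbk[C]^*$ by an algebra isomorphism (one exists, and any choice is allowed). Both kinds of algebras are $H$-cleft extensions of $A$, and an extension of the first kind is not twist equivalent to one of the second kind. (b) In particular, if $G= C_p$, then every $H$-cleft extension of $H^*=\Bbbk[C_p]^*$ is twist equivalent to exactly one of the following two $H$-cleft extensions: the tensor product algebra $\Bbbk[C_p]^*\otimes \Bbbk[C_p]$, and the Heisenberg double $\mathcal H(\Bbbk[C_p]^*)$. -/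

import Mathlib

open scoped TensorProduct

noncomputable section

namespace CleftExt

/-- A left `H`-module algebra structure on the algebra `A`: a left `H`-module structure
`h · a = act h a` with `h · 1 = ε(h) 1` and `h · (a b) = ∑ (h₁ · a) (h₂ · b)`. -/
structure ModuleAlgebra (k H A : Type*) [Field k] [Ring H] [Bialgebra k H]
    [Ring A] [Algebra k A] where
  act : H →ₗ[k] A →ₗ[k] A
  one_act : ∀ a, act 1 a = a
  mul_act : ∀ g h a, act (g * h) a = act g (act h a)
  act_one : ∀ h, act h 1 = algebraMap k A (Coalgebra.counit h)
  act_mul : ∀ h a b, act h (a * b) =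
    LinearMap.mul' k A (TensorProduct.map (act.flip a) (act.flip b) (Coalgebra.comul h))

section Smash

variable {k H A : Type*} [Field k] [Ring H] [Bialgebra k H] [Ring A] [Algebra k A]

/-- `h ↦ ∑ (h₁ · b) ⊗ h₂`. -/
def ModuleAlgebra.twist (M : ModuleAlgebra k H A) (b : A) : H →ₗ[k] A ⊗[k] H :=
  TensorProduct.map (M.act.flip b) LinearMap.id ∘ₗ Coalgebra.comul

/-- The underlying vector space `A ⊗ H` of the smash product `A # H`. It is a separate type, because
its multiplication is not the one of the tensor product algebra. -/
def SmashProduct (_M : ModuleAlgebra k H A) : Type _ := A ⊗[k] H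

namespace SmashProduct

variable (M : ModuleAlgebra k H A)

instance : AddCommGroup (SmashProduct M) := inferInstanceAs (AddCommGroup (A ⊗[k] H))

instance : Module k (SmashProduct M) := inferInstanceAs (Module k (A ⊗[k] H))

/-- The element `a # h`. -/
def mk (a : A) (h : H) : SmashProduct M := (a ⊗ₜ[k] h : A ⊗[k] H)

/-- Left multiplication by `a # h`, written inside `A ⊗ H`: `b # l ↦ ∑ a (h₁ · b) # h₂ l`. -/
def mulInner (a : A) (h : H) : A ⊗[k] H →ₗ[k] A ⊗[k] H :=
  TensorProduct.lift <| LinearMap.mk₂ k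
    (fun b l => (a ⊗ₜ[k] (1 : H)) * M.twist b h * ((1 : A) ⊗ₜ[k] l))
    (by intros; simp [ModuleAlgebra.twist, TensorProduct.map_add_left, mul_add, add_mul])
    (by intros; simp [ModuleAlgebra.twist, TensorProduct.map_smul_left])
    (by intros; simp [TensorProduct.tmul_add, mul_add])
    (by intros; simp)

lemma mulInner_tmul (a b : A) (h l : H) : mulInner M a h (b ⊗ₜ l) =
    (a ⊗ₜ[k] (1 : H)) * M.twist b h * ((1 : A) ⊗ₜ[k] l) := rfl

/-- The multiplication of `A # H`, written inside `A ⊗ H`: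
`(a # h) (b # l) = ∑ a (h₁ · b) # h₂ l`. -/
def mulAux : A ⊗[k] H →ₗ[k] A ⊗[k] H →ₗ[k] A ⊗[k] H :=
  TensorProduct.lift <| LinearMap.mk₂ k (mulInner M)
    (by intros; ext; simp [mulInner_tmul, TensorProduct.add_tmul, add_mul])
    (by
      intro c a h
      ext b l
      have : (c • a) ⊗ₜ[k] (1 : H) = c • (a ⊗ₜ[k] (1 : H)) := rfl
      simp [mulInner_tmul, this])
    (by intros; ext; simp [mulInner_tmul, mul_add, add_mul])
    (by intros; ext; simp [mulInner_tmul])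

lemma mulAux_tmul (a b : A) (h l : H) : mulAux M (a ⊗ₜ h) (b ⊗ₜ l) =
    (a ⊗ₜ[k] (1 : H)) * M.twist b h * ((1 : A) ⊗ₜ[k] l) := rfl

lemma twist_apply (b : A) {h : H} {ι : Type*} (r : Coalgebra.Repr k h ι) :
    M.twist b h = ∑ i ∈ r.index, M.act (r.left i) b ⊗ₜ[k] r.right i := by
  simp [ModuleAlgebra.twist, ← r.eq]

lemma mulAux_tmul_repr (a b : A) (h l : H) {ι : Type*} (r : Coalgebra.Repr k h ι) :
    mulAux M (a ⊗ₜ h) (b ⊗ₜ l) =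
      ∑ i ∈ r.index, (a * M.act (r.left i) b) ⊗ₜ[k] (r.right i * l) := by
  simp [mulAux_tmul, twist_apply M b r, Finset.mul_sum, Finset.sum_mul]

lemma twist_mul_left (c : A) (x y : H) {ι : Type*} (r : Coalgebra.Repr k y ι) :
    M.twist c (x * y) =
      ∑ i ∈ r.index, M.twist (M.act (r.left i) c) x * ((1 : A) ⊗ₜ[k] r.right i) := by
  let s := Coalgebra.Repr.arbitrary k x
  have : Coalgebra.comul (R := k) (x * y) = ∑ i ∈ r.index, ∑ j ∈ s.index,
      (s.left j * r.left i) ⊗ₜ[k] (s.right j * r.right i) := by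
    rw [Bialgebra.comul_mul, ← r.eq, ← s.eq, Finset.mul_sum]
    simp [Finset.sum_mul]
  simp [ModuleAlgebra.twist, this, ← s.eq, M.mul_act, Finset.sum_mul]

lemma twist_mul_right (a b : A) (h : H) {ι : Type*} (r : Coalgebra.Repr k h ι) :
    M.twist (a * b) h =
      ∑ i ∈ r.index, (M.act (r.left i) a ⊗ₜ[k] (1 : H)) * M.twist b (r.right i) := by
  let F : (H ⊗[k] H) ⊗[k] H →ₗ[k] A ⊗[k] H := TensorProduct.map
    (LinearMap.mul' k A ∘ₗ TensorProduct.map (M.act.flip a) (M.act.flip b)) LinearMap.id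
  let G : H ⊗[k] (H ⊗[k] H) →ₗ[k] A ⊗[k] H := LinearMap.mul' k (A ⊗[k] H) ∘ₗ
    TensorProduct.map ((TensorProduct.mk k A H).flip 1 ∘ₗ M.act.flip a)
      (TensorProduct.map (M.act.flip b) LinearMap.id)
  have hFG : F = G ∘ₗ (TensorProduct.assoc k H H H).toLinearMap := by
    ext; simp [F, G]
  have h1 : M.twist (a * b) h = F (Coalgebra.comul.rTensor H (Coalgebra.comul h)) := by
    simp [twist_apply M _ r, ← r.eq, F, M.act_mul]
  have h2 : (∑ i ∈ r.index, (M.act (r.left i) a ⊗ₜ[k] (1 : H)) * M.twist b (r.right i)) =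
      G (Coalgebra.comul.lTensor H (Coalgebra.comul h)) := by
    simp [← r.eq, G, ModuleAlgebra.twist]
  rw [h1, h2, ← Coalgebra.coassoc_apply, hFG]
  rfl

lemma twist_right_one (h : H) : M.twist 1 h = (1 : A) ⊗ₜ[k] h := by
  let r := Coalgebra.Repr.arbitrary k h
  have := congrArg (TensorProduct.map (Algebra.linearMap k A) (LinearMap.id (R := k) (M := H)))
    (Coalgebra.rTensor_counit_comul (R := k) h)
  rw [← r.eq] at this
  simp only [map_sum, LinearMap.rTensor_tmul, TensorProduct.map_tmul, Algebra.linearMap_apply,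
    LinearMap.id_apply, map_one] at this
  rw [twist_apply M 1 r, ← this]
  simp [M.act_one]

lemma twist_left_one (b : A) : M.twist b 1 = b ⊗ₜ[k] (1 : H) := by
  simp [ModuleAlgebra.twist, Algebra.TensorProduct.one_def, M.one_act]

lemma mulAux_one_left (x : A ⊗[k] H) : mulAux M ((1 : A) ⊗ₜ[k] (1 : H)) x = x := by
  induction x with
  | zero => simp
  | add x y hx hy => rw [map_add, hx, hy]
  | tmul b l => simp [mulAux_tmul, twist_left_one]

lemma mulAux_one_right (x : A ⊗[k] H) : mulAux M x ((1 : A) ⊗ₜ[k] (1 : H)) = x := by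
  induction x with
  | zero => simp
  | add x y hx hy => rw [map_add, LinearMap.add_apply, hx, hy]
  | tmul b l => simp [mulAux_tmul, twist_right_one]

lemma mulAux_mul_right (x y : A ⊗[k] H) (m : H) :
    mulAux M x (y * ((1 : A) ⊗ₜ[k] m)) = mulAux M x y * ((1 : A) ⊗ₜ[k] m) := by
  induction x with
  | zero => simp
  | add x y hx hy => simp [hx, hy, add_mul]
  | tmul a h =>
    induction y with
    | zero => simp
    | add x y hx hy => simp [hx, hy, add_mul]
    | tmul b l => simp [mulAux_tmul, mul_assoc]

lemma mulAux_mul_left (a : A) (x y : A ⊗[k] H) :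
    mulAux M ((a ⊗ₜ[k] (1 : H)) * x) y = (a ⊗ₜ[k] (1 : H)) * mulAux M x y := by
  induction x with
  | zero => simp
  | add x y hx hy => simp [hx, hy, mul_add]
  | tmul b h =>
    induction y with
    | zero => simp
    | add x y hx hy => rw [map_add, hx, hy, map_add, mul_add]
    | tmul c l =>
      simp only [Algebra.TensorProduct.tmul_mul_tmul, one_mul, mulAux_tmul, ← mul_assoc]

lemma mulAux_assoc (x y z : A ⊗[k] H) :
    mulAux M (mulAux M x y) z = mulAux M x (mulAux M y z) := by
  induction x with
  | zero => simp
  | add x y hx hy => simp [hx, hy]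
  | tmul a h =>
  induction y with
  | zero => simp
  | add x y hx hy => simp [hx, hy]
  | tmul b l =>
  induction z with
  | zero => simp
  | add x y hx hy => simp [hx, hy]
  | tmul c m =>
    let r := Coalgebra.Repr.arbitrary k h
    let s := Coalgebra.Repr.arbitrary k l
    rw [mulAux_tmul_repr M a b h l r, mulAux_tmul_repr M b c l m s]
    simp only [map_sum, LinearMap.sum_apply, mulAux_tmul, twist_mul_left M c _ l s,
      twist_mul_right M b _ h r]
    simp only [Finset.mul_sum, Finset.sum_mul]
    rw [Finset.sum_comm]
    refine Finset.sum_congr rfl fun i _ => Finset.sum_congr rfl fun j _ => ?_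
    have e1 : ((a * M.act (r.left j) b) ⊗ₜ[k] (1 : H)) =
        (a ⊗ₜ[k] (1 : H)) * (M.act (r.left j) b ⊗ₜ[k] (1 : H)) := by simp
    have e2 : ((1 : A) ⊗ₜ[k] (s.right i * m)) =
        ((1 : A) ⊗ₜ[k] s.right i) * ((1 : A) ⊗ₜ[k] m) := by simp
    rw [e1, e2]
    simp only [mul_assoc]

instance : Ring (SmashProduct M) where
  __ := (inferInstance : AddCommGroup (SmashProduct M))
  mul x y := mulAux M x y
  one := mk M 1 1
  mul_assoc := mulAux_assoc M
  one_mul := mulAux_one_left M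
  mul_one := mulAux_one_right M
  left_distrib x y z := map_add (mulAux M x) y z
  right_distrib x y z := LinearMap.map_add₂ (mulAux M) x y z
  zero_mul x := LinearMap.map_zero₂ (mulAux M) x
  mul_zero x := map_zero (mulAux M x)

instance : Algebra k (SmashProduct M) :=
  Algebra.ofModule (fun r x y => LinearMap.map_smul₂ (mulAux M) r x y)
    (fun r x y => map_smul (mulAux M x) r y)

lemma mul_def (x y : SmashProduct M) : x * y = mulAux M x y := rfl

/-- The multiplication rule `(a # h) (b # l) = ∑ a (h₁ · b) # h₂ l`. -/
lemma mk_mul_mk (a b : A) (h l : H) {ι : Type*} (r : Coalgebra.Repr k h ι) :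
    mk M a h * mk M b l = ∑ i ∈ r.index, mk M (a * M.act (r.left i) b) (r.right i * l) :=
  mulAux_tmul_repr M a b h l r

/-- The embedding `a ↦ a # 1` of `A` in `A # H`. -/
def incl : A →ₐ[k] SmashProduct M :=
  AlgHom.ofLinearMap ((TensorProduct.mk k A H).flip 1 : A →ₗ[k] A ⊗[k] H) rfl
    (fun a b => by
      change (a * b) ⊗ₜ[k] (1 : H) = mulAux M (a ⊗ₜ 1) (b ⊗ₜ 1)
      simp [mulAux_tmul, twist_left_one])

/-- The underlying linear map of the coaction, `a # h ↦ ∑ (a # h₁) ⊗ h₂`. -/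
def coactLin : SmashProduct M →ₗ[k] SmashProduct M ⊗[k] H :=
  ((TensorProduct.assoc k A H H).symm.toLinearMap ∘ₗ
    (Coalgebra.comul (R := k) (A := H)).lTensor A : A ⊗[k] H →ₗ[k] (A ⊗[k] H) ⊗[k] H)

lemma coactLin_mk (a : A) {h : H} {ι : Type*} (r : Coalgebra.Repr k h ι) :
    coactLin M (mk M a h) = ∑ i ∈ r.index, mk M a (r.left i) ⊗ₜ[k] r.right i := by
  change (TensorProduct.assoc k A H H).symm
    (Coalgebra.comul.lTensor A (a ⊗ₜ[k] h)) = _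
  rw [LinearMap.lTensor_tmul, ← r.eq, TensorProduct.tmul_sum, map_sum]
  rfl

lemma coactLin_mul_mk (a b : A) (h l : H) :
    coactLin M (mk M a h * mk M b l) = coactLin M (mk M a h) * coactLin M (mk M b l) := by
  let r := Coalgebra.Repr.arbitrary k h
  let s := Coalgebra.Repr.arbitrary k l
  let Φ (j : H × H) : H ⊗[k] (H ⊗[k] H) →ₗ[k] SmashProduct M ⊗[k] H :=
    ((TensorProduct.assoc k A H H).symm.toLinearMap ∘ₗ
      TensorProduct.map (LinearMap.mulLeft k a ∘ₗ M.act.flip b)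
        (TensorProduct.map (LinearMap.mulRight k (s.left j)) (LinearMap.mulRight k (s.right j))) :
      H ⊗[k] (H ⊗[k] H) →ₗ[k] (A ⊗[k] H) ⊗[k] H)
  have hΦ (j : H × H) (x y z : H) : Φ j (x ⊗ₜ (y ⊗ₜ z)) =
      mk M (a * M.act x b) (y * s.left j) ⊗ₜ[k] (z * s.right j) := rfl
  have key := fun j => congrArg (Φ j) (Coalgebra.sum_tmul_tmul_eq r
    (fun i => Coalgebra.Repr.arbitrary k (r.left i))
    (fun i => Coalgebra.Repr.arbitrary k (r.right i)))
  simp only [map_sum, hΦ] at key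
  have hl (i : H × H) : coactLin M (mk M (a * M.act (r.left i) b) (r.right i * l)) =
      ∑ j ∈ s.index, ∑ q ∈ (Coalgebra.Repr.arbitrary k (r.right i)).index,
        mk M (a * M.act (r.left i) b)
          ((Coalgebra.Repr.arbitrary k (r.right i)).left q * s.left j) ⊗ₜ[k]
          ((Coalgebra.Repr.arbitrary k (r.right i)).right q * s.right j) := by
    let t := Coalgebra.Repr.arbitrary k (r.right i)
    change (TensorProduct.assoc k A H H).symm
      (Coalgebra.comul.lTensor A ((a * M.act (r.left i) b) ⊗ₜ[k] (r.right i * l))) = _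
    rw [LinearMap.lTensor_tmul, Bialgebra.comul_mul, ← t.eq, ← s.eq, Finset.sum_mul_sum,
      Finset.sum_comm]
    simp only [Algebra.TensorProduct.tmul_mul_tmul, TensorProduct.tmul_sum, map_sum]
    rfl
  rw [mk_mul_mk M a b h l r, map_sum, coactLin_mk M a r, coactLin_mk M b s, Finset.sum_mul_sum]
  simp only [hl, Algebra.TensorProduct.tmul_mul_tmul]
  rw [Finset.sum_comm, Finset.sum_comm (s := r.index)]
  refine Finset.sum_congr rfl fun j _ => ?_
  rw [← key j]
  refine Finset.sum_congr rfl fun i _ => ?_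
  rw [mk_mul_mk M a b _ _ (Coalgebra.Repr.arbitrary k (r.left i)), TensorProduct.sum_tmul]

lemma mk_induction {P : SmashProduct M → Prop} (zero : P 0)
    (add : ∀ x y, P x → P y → P (x + y)) (mk : ∀ a h, P (mk M a h)) (x : SmashProduct M) : P x :=
  TensorProduct.induction_on (motive := P) x zero mk add

/-- The coaction `a # h ↦ ∑ (a # h₁) ⊗ h₂` of `H` on `A # H`. -/
def coact : SmashProduct M →ₐ[k] SmashProduct M ⊗[k] H :=
  AlgHom.ofLinearMap (coactLin M)
    (by
      change (TensorProduct.assoc k A H H).symm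
        (Coalgebra.comul.lTensor A ((1 : A) ⊗ₜ[k] (1 : H))) = _
      simp only [LinearMap.lTensor_tmul, Bialgebra.comul_one, Algebra.TensorProduct.one_def]
      rfl)
    (fun x y => by
      induction x using mk_induction with
      | zero => simp
      | add x y hx hy => simp only [add_mul, map_add, hx, hy]
      | mk a h =>
        induction y using mk_induction with
        | zero => simp
        | add x y hx hy => simp only [mul_add, map_add, hx, hy]
        | mk b l => exact coactLin_mul_mk M a b h l)

end SmashProduct

end Smash

/-- The algebra `H^*`: linear forms on `H` under the convolution product. -/
abbrev DualAlg (k H : Type*) [Field k] [Ring H] [Bialgebra k H] : Type _ :=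
  WithConv (H →ₗ[k] k)

/-- The action `h ⇀ f = ∑ f₂(h) f₁` of `H` on `H^*`. As `∑ f₁(x) f₂(h) = f (x h)`, this is
`(h ⇀ f)(x) = f (x h)`. -/
def harpoon (k H : Type*) [Field k] [Ring H] [Bialgebra k H] :
    ModuleAlgebra k H (DualAlg k H) where
  act := LinearMap.mk₂ k
    (fun h f => WithConv.toConv (f.ofConv ∘ₗ LinearMap.mulRight k h))
    (fun h h' f => by ext x; simp [mul_add])
    (fun c h f => by ext x; simp)
    (fun h f f' => by ext x; simp)
    (fun c h f => by ext x; simp)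
  one_act f := by ext x; simp
  mul_act g h f := by ext x; simp [mul_assoc]
  act_one h := by
    ext x
    simp [LinearMap.convOne_def, mul_comm]
  act_mul h f g := by
    ext x
    let r := Coalgebra.Repr.arbitrary k h
    let s := Coalgebra.Repr.arbitrary k x
    have hx : Coalgebra.comul (R := k) (x * h) = ∑ i ∈ r.index, ∑ j ∈ s.index,
        (s.left j * r.left i) ⊗ₜ[k] (s.right j * r.right i) := by
      rw [Bialgebra.comul_mul, ← r.eq, ← s.eq, Finset.mul_sum]
      simp [Finset.sum_mul]
    simp [hx, ← r.eq, s.convMul_apply]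

/-- The Heisenberg double `𝓗(H^*) = H^* # H`. -/
abbrev HeisenbergDouble (k H : Type*) [Field k] [Ring H] [Bialgebra k H] : Type _ :=
  SmashProduct (harpoon k H)

/-- An algebra `B` with an algebra map `A → B` and an algebra map `B → B ⊗ H`: the data of an
extension of `A` by an `H`-comodule algebra. -/
structure ExtData (k A H B : Type*) [Field k] [Ring A] [Algebra k A] [Ring H] [HopfAlgebra k H]
    [Ring B] [Algebra k B] where
  incl : A →ₐ[k] B
  coact : B →ₐ[k] B ⊗[k] H

namespace ExtData

section

variable {k A H B B' : Type*} [Field k] [Ring A] [Algebra k A] [Ring H] [HopfAlgebra k H]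
  [Ring B] [Algebra k B] [Ring B'] [Algebra k B']

/-- `B` is an `H`-cleft extension of `A`: `B` is a right `H`-comodule algebra, `A` is identified by
`incl` with the subalgebra `B^{co H}` of `B`, and there is a convolution invertible right
`H`-comodule map `γ : H → B`. -/
structure IsCleft (E : ExtData k A H B) : Prop where
  coassoc : ∀ b, TensorProduct.assoc k B H H (E.coact.toLinearMap.rTensor H (E.coact b)) =
    (Coalgebra.comul (R := k) (A := H)).lTensor B (E.coact b)
  counit : ∀ b, (Coalgebra.counit (R := k) (A := H)).lTensor B (E.coact b) = b ⊗ₜ[k] (1 : k)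
  incl_injective : Function.Injective E.incl
  mem_range_incl : ∀ b, b ∈ E.incl.range ↔ E.coact b = b ⊗ₜ[k] (1 : H)
  exists_cleft : ∃ γ : H →ₗ[k] B,
    (∀ h, E.coact (γ h) = γ.rTensor H (Coalgebra.comul h)) ∧ IsUnit (WithConv.toConv γ)

/-- Twist equivalence: there are an algebra automorphism `φA` of `A`, a Hopf algebra automorphism
`φH` of `H` and an algebra isomorphism `f` from `B` to `B'` which is `A`-linear for the `A`-action
on `B'` twisted by `φA` and `H`-colinear for the coaction on `B'` twisted by `φH`. -/
def TwistEquiv (E : ExtData k A H B) (E' : ExtData k A H B') : Prop :=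
  ∃ (φA : A ≃ₐ[k] A) (φH : H ≃ₐc[k] H) (f : B ≃ₐ[k] B'),
    (∀ a b, f (E.incl a * b) = E'.incl (φA a) * f b) ∧
    ∀ b, (φH : H →ₗ[k] H).lTensor B' (E'.coact (f b)) =
      (f : B →ₗ[k] B').rTensor H (E.coact b)

/-- The restriction of the base of an extension along an identification `ι : A' ≃ A`. -/
def rebase {A' : Type*} [Ring A'] [Algebra k A'] (E : ExtData k A H B) (ι : A' ≃ₐ[k] A) :
    ExtData k A' H B where
  incl := E.incl.comp ι
  coact := E.coact

/-- The extension `B ⊗ K` of `A`, with coaction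
`b ⊗ x ↦ ∑ (b₀ ⊗ x₁) ⊗ m (b₁ ⊗ x₂)`, where `m : H ⊗ K → L` identifies `H ⊗ K` with `L`. -/
def tensorHopf {K L : Type*} [Ring K] [HopfAlgebra k K] [Ring L] [HopfAlgebra k L]
    (E : ExtData k A H B) (m : H ⊗[k] K →ₐ[k] L) : ExtData k A L (B ⊗[k] K) where
  incl := Algebra.TensorProduct.includeLeft.comp E.incl
  coact := (Algebra.TensorProduct.map (AlgHom.id k (B ⊗[k] K)) m).comp <|
    (Algebra.TensorProduct.tensorTensorTensorComm k k k k B H K K).toAlgHom.comp <|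
      Algebra.TensorProduct.map E.coact (Bialgebra.comulAlgHom k K)

end

/-- The tensor product algebra `A ⊗ H`, with coaction `a ⊗ h ↦ ∑ (a ⊗ h₁) ⊗ h₂`. -/
def tensor (k A H : Type*) [Field k] [Ring A] [Algebra k A] [Ring H] [HopfAlgebra k H] :
    ExtData k A H (A ⊗[k] H) where
  incl := Algebra.TensorProduct.includeLeft
  coact := (Algebra.TensorProduct.assoc k k k A H H).symm.toAlgHom.comp <|
    Algebra.TensorProduct.map (AlgHom.id k A) (Bialgebra.comulAlgHom k H)

/-- The smash product `A # H` as an extension of `A`. -/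
def smash {k A H : Type*} [Field k] [Ring A] [Algebra k A] [Ring H] [HopfAlgebra k H]
    (M : ModuleAlgebra k H A) : ExtData k A H (SmashProduct M) where
  incl := SmashProduct.incl M
  coact := SmashProduct.coact M

/-- The Heisenberg double `𝓗(H^*)` as an extension of `H^*`. -/
def heisenberg (k H : Type*) [Field k] [Ring H] [HopfAlgebra k H] :
    ExtData k (DualAlg k H) H (HeisenbergDouble k H) :=
  smash (harpoon k H)

/-- The extension `𝓗(k[C]^*) ⊗ k[G']` of `A`, for subgroups `C` and `G'` of `G`. Here `A` is
identified with `k[C]^*` by `ι`, and `k[C] ⊗ k[G']` is mapped to `k[G]` by `c ⊗ g ↦ c g`. -/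
def heisenbergTensor (k : Type*) {A G : Type*} [Field k] [CommGroup G] [Ring A] [Algebra k A]
    (C G' : Subgroup G) (ι : A ≃ₐ[k] DualAlg k (MonoidAlgebra k C)) :
    ExtData k A (MonoidAlgebra k G)
      (HeisenbergDouble k (MonoidAlgebra k C) ⊗[k] MonoidAlgebra k G') :=
  ((heisenberg k (MonoidAlgebra k C)).tensorHopf
    (Algebra.TensorProduct.productMap
      (MonoidAlgebra.mapDomainBialgHom k C.subtype : MonoidAlgebra k C →ₐ[k] MonoidAlgebra k G)
      (MonoidAlgebra.mapDomainBialgHom k G'.subtype :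
        MonoidAlgebra k G' →ₐ[k] MonoidAlgebra k G))).rebase ι

end ExtData

/-- The algebra `k[x]/(x^p - x)`. -/
abbrev BaseAlg (k : Type*) [Field k] (p : ℕ) : Type _ :=
  AdjoinRoot (Polynomial.X ^ p - Polynomial.X : Polynomial k)

end CleftExt

end

/-!
A coaction of `k[G]` on an algebra is a `G`-grading. A cleaving map takes each `g` to a homogeneous
unit `u_g`, so a `k[G]`-cleft extension `B` of `A` is a crossed product: `B_g = A u_g`. Conversely
a `G`-graded algebra spanned over its base by homogeneous units is cleft (`isCleft_of_units`), and
a graded homomorphism of cleft extensions that is bijective on the bases is bijective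
(`IsCleft.bijective_of_morphism`). It is therefore enough to map the right model to `B`.

Conjugation by the `u_g` is an action of `G` on the commutative algebra `A`. The algebra
`k[x]/(x ^ p - x)`, like the dual of `k[C_p]`, is the algebra of functions on `p` points, and the
`p`-group `G` permutes these points. Either it fixes all of them, or it is transitive, and then the
stabilizer `K` of a point has index `p` and acts trivially, as `G` is abelian
(`action_dichotomy`).

There are no cohomological obstructions, for the following reason. Let `g` act trivially on `A`.
Units of `A` have unique `p`-th roots, so `g` has exactly one homogeneous lift whose `p`-th power
is `1`. By uniqueness it commutes with every homogeneous unit, so these lifts are closed under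
products and form a group (`exists_lift_of_trivial`). If `G` acts trivially, this gives
`A ⊗ k[G] → B`.

If `G` is transitive on the points, a complement `C` of `K` is generated by any element outside
`K`. The `p`-th power of a lift of a generator is fixed by `C`, hence a scalar, and can be
normalized to `1`, so `C` lifts as well (`exists_lift_of_transitive`). It acts simply transitively
on the points; a base point identifies `A` with the functions on `C`, and the action of `C` with
`⇀`. This gives `𝓗(k[C]^*) ⊗ k[K] → B`.

The two kinds of models are told apart by commutativity.
-/

noncomputable section

namespace CleftExt

/-! ### Gradings and cleft extensions -/

/-- The linear map `B ⊗ k[G] → B` that reads off the coefficient of `g`. -/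
def tensorCoeff (k B : Type*) {G : Type*} [Field k] [AddCommGroup B] [Module k B] [Group G]
    (g : G) : B ⊗[k] MonoidAlgebra k G →ₗ[k] B :=
  (TensorProduct.rid k B).toLinearMap ∘ₗ
    (Finsupp.lapply g ∘ₗ (MonoidAlgebra.coeffLinearEquiv k).toLinearMap).lTensor B

section Coeff

variable {k B G : Type*} [Field k] [AddCommGroup B] [Module k B] [Group G]

open Classical in
lemma tensorCoeff_tmul_single (g h : G) (b : B) :
    tensorCoeff k B g (b ⊗ₜ[k] MonoidAlgebra.single h 1) = if h = g then b else 0 := by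
  simp [tensorCoeff, Finsupp.single_apply]

lemma sum_tensorCoeff_tmul [Fintype G] (t : B ⊗[k] MonoidAlgebra k G) :
    ∑ g, tensorCoeff k B g t ⊗ₜ[k] MonoidAlgebra.single g (1 : k) = t := by
  classical
  induction t with
  | zero => simp
  | add x y hx hy => simp only [map_add, TensorProduct.add_tmul, Finset.sum_add_distrib, hx, hy]
  | tmul b x =>
    induction x using MonoidAlgebra.induction_linear with
    | zero => simp
    | add x y hx hy =>
      simp only [TensorProduct.tmul_add, map_add, TensorProduct.add_tmul, Finset.sum_add_distrib,
        hx, hy]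
    | single h r =>
      have : MonoidAlgebra.single h r = r • MonoidAlgebra.single h (1 : k) := by simp
      rw [this, ← TensorProduct.smul_tmul]
      simp only [tensorCoeff_tmul_single]
      rw [Finset.sum_eq_single h] <;> simp +contextual [eq_comm]

end Coeff

namespace ExtData

variable {k A G B : Type*} [Field k] [Ring A] [Algebra k A] [Group G] [Ring B] [Algebra k B]

/-- A coaction of `k[G]` is a `G`-grading; `b` is homogeneous of degree `g` when
`ρ(b) = b ⊗ g`. -/
def IsHomog (E : ExtData k A (MonoidAlgebra k G) B) (g : G) (b : B) : Prop :=
  E.coact b = b ⊗ₜ[k] MonoidAlgebra.single g (1 : k)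

variable {E : ExtData k A (MonoidAlgebra k G) B}

lemma IsHomog.mul {g h : G} {b c : B} (hb : E.IsHomog g b) (hc : E.IsHomog h c) :
    E.IsHomog (g * h) (b * c) := by
  unfold IsHomog at *
  simp [hb, hc]

lemma isHomog_one : E.IsHomog 1 (1 : B) := by
  unfold IsHomog
  simp [Algebra.TensorProduct.one_def, MonoidAlgebra.one_def]

lemma IsHomog.pow {g : G} {b : B} (hb : E.IsHomog g b) (n : ℕ) : E.IsHomog (g ^ n) (b ^ n) := by
  induction n with
  | zero => simpa using isHomog_one
  | succ n ih => simpa [pow_succ] using ih.mul hb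

lemma IsHomog.inv {g : G} {u : Bˣ} (hu : E.IsHomog g (u : B)) :
    E.IsHomog g⁻¹ ((u⁻¹ : Bˣ) : B) := by
  unfold IsHomog at *
  refine left_inv_eq_right_inv (a := E.coact u) ?_ ?_
  · rw [← map_mul]; simp
  · rw [hu]
    simp [Algebra.TensorProduct.one_def, MonoidAlgebra.one_def]

lemma IsHomog.zpow {g : G} {u : Bˣ} (hu : E.IsHomog g (u : B)) (n : ℤ) :
    E.IsHomog (g ^ n) ((u ^ n : Bˣ) : B) := by
  cases n with
  | ofNat n => simpa using hu.pow n
  | negSucc n =>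
    simp only [zpow_negSucc, ← inv_pow]
    simpa using hu.inv.pow (n + 1)

/-- Components of different degrees are independent. -/
lemma IsHomog.eq_of_sum_eq [Fintype G] {b c : G → B} (hb : ∀ g, E.IsHomog g (b g))
    (hc : ∀ g, E.IsHomog g (c g)) (h : ∑ g, b g = ∑ g, c g) (g : G) : b g = c g := by
  classical
  have := congrArg (fun x => tensorCoeff k B g (E.coact x)) h
  simp only [map_sum] at this
  simp only [IsHomog] at hb hc
  simpa [hb, hc, tensorCoeff_tmul_single] using this

namespace IsCleft

variable (hE : E.IsCleft)
include hE

lemma isHomog_incl (a : A) : E.IsHomog 1 (E.incl a) :=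
  (hE.mem_range_incl _).1 ⟨a, rfl⟩

lemma exists_incl_eq {b : B} (hb : E.IsHomog 1 b) : ∃ a, E.incl a = b :=
  (hE.mem_range_incl b).2 hb

lemma exists_sum_isHomog [Fintype G] (b : B) :
    ∃ c : G → B, (∀ g, E.IsHomog g (c g)) ∧ ∑ g, c g = b := by
  classical
  let c : G → B := fun g => tensorCoeff k B g (E.coact b)
  have hc : ∑ g, c g ⊗ₜ[k] MonoidAlgebra.single g (1 : k) = E.coact b := sum_tensorCoeff_tmul _
  refine ⟨c, fun g => ?_, ?_⟩
  -- Coassociativity says `∑ ρ(c_g) ⊗ g = ∑ c_g ⊗ g ⊗ g`; compare coefficients of `g`.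
  · have h1 := congrArg (fun t => tensorCoeff k _ g ((TensorProduct.assoc k B _ _).symm t))
      (hE.coassoc b)
    rw [← hc] at h1
    simpa [tensorCoeff_tmul_single, IsHomog] using h1
  · have h1 := congrArg (TensorProduct.rid k B) (hE.counit b)
    rw [← hc] at h1
    simpa using h1

/-- A cleaving map takes group elements to homogeneous units. -/
lemma exists_unit (g : G) : ∃ u : Bˣ, E.IsHomog g (u : B) := by
  obtain ⟨γ, hγ, hu⟩ := hE.exists_cleft
  obtain ⟨δ, h1, h2⟩ := isUnit_iff_exists.1 hu
  have e1 := congrArg (fun f => f.ofConv (MonoidAlgebra.single g (1 : k))) h1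
  have e2 := congrArg (fun f => f.ofConv (MonoidAlgebra.single g (1 : k))) h2
  simp [LinearMap.convOne_def] at e1 e2
  refine ⟨⟨γ (MonoidAlgebra.single g 1), δ.ofConv (MonoidAlgebra.single g 1), e1, e2⟩, ?_⟩
  simp [IsHomog, hγ]

lemma exists_incl_mul_eq {g : G} {u : Bˣ} (hu : E.IsHomog g (u : B)) {b : B}
    (hb : E.IsHomog g b) : ∃ a, E.incl a * u = b := by
  obtain ⟨a, ha⟩ := hE.exists_incl_eq (b := b * (u⁻¹ : Bˣ)) (by simpa using hb.mul hu.inv)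
  exact ⟨a, by simp [ha]⟩

end IsCleft

/-- An extension by `k[G]` is cleft as soon as it is spanned over `A` by homogeneous units. -/
lemma isCleft_of_units [Finite G] (hinj : Function.Injective E.incl)
    (hincl : ∀ a, E.IsHomog 1 (E.incl a)) (u : G → Bˣ) (hu : ∀ g, E.IsHomog g (u g : B))
    (hu1 : u 1 = 1) (hspan : ∀ b, b ∈ Submodule.span k {x | ∃ a g, x = E.incl a * (u g : B)}) :
    E.IsCleft := by
  classical
  have := Fintype.ofFinite G
  have hau (a g) : E.coact (E.incl a * (u g : B)) =
      (E.incl a * (u g : B)) ⊗ₜ[k] MonoidAlgebra.single g (1 : k) := by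
    have := (hincl a).mul (hu g)
    rwa [one_mul] at this
  have hdec (b : B) : ∃ c : G → A, b = ∑ g, E.incl (c g) * (u g : B) := by
    induction hspan b using Submodule.span_induction with
    | mem x h =>
      obtain ⟨a, g, rfl⟩ := h
      refine ⟨Pi.single g a, ?_⟩
      rw [Finset.sum_eq_single g] <;> simp +contextual
    | zero => exact ⟨0, by simp⟩
    | add x y _ _ hx hy =>
      obtain ⟨c, rfl⟩ := hx
      obtain ⟨d, rfl⟩ := hy
      exact ⟨c + d, by simp [add_mul, Finset.sum_add_distrib]⟩
    | smul r x _ hx =>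
      obtain ⟨c, rfl⟩ := hx
      exact ⟨r • c, by simp [Finset.smul_sum]⟩
  refine ⟨fun b => ?_, fun b => ?_, hinj, fun b => ⟨?_, fun hb => ?_⟩, ?_⟩
  · obtain ⟨c, rfl⟩ := hdec b
    simp only [map_sum, hau, LinearMap.rTensor_tmul, LinearMap.lTensor_tmul,
      AlgHom.toLinearMap_apply, TensorProduct.assoc_tmul, MonoidAlgebra.comul_single]
    simp
  · obtain ⟨c, rfl⟩ := hdec b
    simp only [map_sum, hau, LinearMap.lTensor_tmul, MonoidAlgebra.counit_single,
      TensorProduct.sum_tmul]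
    simp
  · rintro ⟨a, rfl⟩
    exact hincl a
  · obtain ⟨c, rfl⟩ := hdec b
    have := congrArg (tensorCoeff k B (1 : G)) hb
    simp only [map_sum, hau] at this
    rw [MonoidAlgebra.one_def] at this
    simp only [tensorCoeff_tmul_single, Finset.sum_ite_eq', Finset.mem_univ, if_true, hu1,
      Units.val_one, mul_one] at this
    exact ⟨c 1, this⟩
  -- The convolution inverse of the cleaving map `g ↦ u_g` is `g ↦ u_g⁻¹`.
  · let lin (f : G → B) : MonoidAlgebra k G →ₗ[k] B :=
      Finsupp.linearCombination k f ∘ₗ (MonoidAlgebra.coeffLinearEquiv k).toLinearMap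
    have hlin (f : G → B) (g : G) : lin f (MonoidAlgebra.single g 1) = f g := by simp [lin]
    refine ⟨lin fun g => u g, fun h => ?_, isUnit_iff_exists.2
      ⟨WithConv.toConv (lin fun g => ((u g)⁻¹ : Bˣ)), ?_, ?_⟩⟩
    · induction h using MonoidAlgebra.induction_linear with
      | zero => simp
      | add x y hx hy => simp only [map_add, hx, hy]
      | single g r =>
        have : MonoidAlgebra.single g r = r • MonoidAlgebra.single g (1 : k) := by simp
        rw [this]
        have h1 := hu g
        unfold IsHomog at h1
        simp only [map_smul, hlin, h1, MonoidAlgebra.comul_single]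
        simp [hlin]
    all_goals
      ext g
      simp [LinearMap.convOne_def, hlin]

/-- A morphism of cleft extensions that is bijective on the base is bijective, because in every
degree both sides are free of rank one over the base on a unit. -/
lemma IsCleft.bijective_of_morphism [Finite G] {A' B' : Type*} [Ring A'] [Algebra k A'] [Ring B']
    [Algebra k B'] {E' : ExtData k A' (MonoidAlgebra k G) B'} (hE : E.IsCleft) (hE' : E'.IsCleft)
    (φ : A ≃ₐ[k] A') (F : B →ₐ[k] B') (hF : ∀ a, F (E.incl a) = E'.incl (φ a))
    (hhom : ∀ g b, E.IsHomog g b → E'.IsHomog g (F b)) : Function.Bijective F := by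
  have := Fintype.ofFinite G
  choose u hu using hE.exists_unit
  have hFu (g : G) : E'.IsHomog g (Units.map (F : B →* B') (u g) : B') := hhom g _ (hu g)
  constructor
  · refine (injective_iff_map_eq_zero F).2 fun b hb => ?_
    obtain ⟨c, hc, rfl⟩ := hE.exists_sum_isHomog b
    refine Finset.sum_eq_zero fun g _ => ?_
    have h0 : F (c g) = 0 := by
      refine IsHomog.eq_of_sum_eq (E := E') (b := fun g => F (c g)) (c := 0)
        (fun g => hhom g _ (hc g)) (fun g => by simp [IsHomog]) ?_ g
      simpa using hb
    obtain ⟨a, ha⟩ := hE.exists_incl_mul_eq (hu g) (hc g)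
    rw [← ha, map_mul, hF] at h0
    have h1 : E'.incl (φ a) = 0 := by
      have := (Units.mul_left_eq_zero (Units.map (F : B →* B') (u g))).1 h0
      exact this
    have h2 : a = 0 := by
      have := hE'.incl_injective (h1.trans (map_zero E'.incl).symm)
      simpa using this
    simp [← ha, h2]
  · intro b
    obtain ⟨c, hc, rfl⟩ := hE'.exists_sum_isHomog b
    have : ∀ g, ∃ a, F a = c g := fun g => by
      obtain ⟨a, ha⟩ := hE'.exists_incl_mul_eq (hFu g) (hc g)
      exact ⟨E.incl (φ.symm a) * u g, by rw [← ha, map_mul, hF]; simp⟩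
    choose a ha using this
    exact ⟨∑ g, a g, by simp [ha]⟩

/-- A morphism of cleft extensions from a model to `E`, bijective on the base, makes `E` twist
equivalent to the model. The degree needs to be checked on one unit per degree only. -/
lemma IsCleft.twistEquiv_of_morphism [Finite G] {B' : Type*} [Ring B']
    [Algebra k B'] {E' : ExtData k A (MonoidAlgebra k G) B'} (hE : E.IsCleft) (hE' : E'.IsCleft)
    (φ : A ≃ₐ[k] A) (F : B' →ₐ[k] B) (hF : ∀ a, F (E'.incl a) = E.incl (φ a))
    (hunit : ∀ g, ∃ u : B'ˣ, E'.IsHomog g (u : B') ∧ E.IsHomog g (F u)) : E.TwistEquiv E' := by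
  have := Fintype.ofFinite G
  have hhom (g : G) (b : B') (hb : E'.IsHomog g b) : E.IsHomog g (F b) := by
    obtain ⟨u, hu, hFu⟩ := hunit g
    obtain ⟨a, rfl⟩ := hE'.exists_incl_mul_eq hu hb
    have := (hE.isHomog_incl (φ a)).mul hFu
    rwa [one_mul, ← hF, ← map_mul] at this
  let f := AlgEquiv.ofBijective F (hE'.bijective_of_morphism hE φ F hF hhom)
  refine ⟨φ.symm, BialgEquiv.refl k _, f.symm, fun a b => f.injective ?_, fun b => ?_⟩
  · have : f (E'.incl (φ.symm a)) = E.incl a := by simp [f, hF]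
    simp [this]
  · obtain ⟨b, rfl⟩ := f.surjective b
    obtain ⟨c, hc, rfl⟩ := hE'.exists_sum_isHomog b
    have h1 (g : G) : E.coact (f (c g)) = _ := hhom g _ (hc g)
    have h2 (g : G) : E'.coact (c g) = _ := hc g
    have h3 (g : G) : f.symm (F (c g)) = c g := f.symm_apply_apply _
    simp [h1, h2, h3]

end ExtData

/-! ### Algebras of functions on `p` points and the dual of a group algebra -/

section Points

variable {k A X : Type*} [Field k] [Ring A] [Algebra k A] (e : A ≃ₐ[k] (X → k))
include e

lemma mul_comm_of_equiv_pi (a b : A) : a * b = b * a :=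
  e.injective (by rw [map_mul, map_mul, mul_comm])

lemma eq_of_forall_point {a b : A} (h : ∀ x : A →ₐ[k] k, x a = x b) : a = b :=
  e.injective (funext fun i => h ((Pi.evalAlgHom k (fun _ => k) i).comp e.toAlgHom))

/-- The points of `k^X`, for finite `X`, are the evaluations. -/
lemma bijective_eval [Finite X] : Function.Bijective
    fun i : X => (Pi.evalAlgHom k (fun _ => k) i).comp (e : A →ₐ[k] (X → k)) := by
  classical
  have := Fintype.ofFinite X
  constructor
  · intro i j hij
    have := DFunLike.congr_fun hij (e.symm (Pi.single i 1))
    by_contra hne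
    simp [Ne.symm hne] at this
  · intro x
    obtain ⟨i, hi⟩ : ∃ i, x (e.symm (Pi.single i 1)) ≠ 0 := by
      by_contra! h
      have h1 : ∑ i, e.symm (Pi.single i 1) = 1 := by
        rw [← map_sum, Finset.univ_sum_single (fun _ : X => (1 : k))]
        exact map_one e.symm
      have := congrArg x h1
      simp [h] at this
    refine ⟨i, AlgHom.ext fun a => ?_⟩
    have h2 : a * e.symm (Pi.single i 1) = e a i • e.symm (Pi.single i 1) := by
      apply e.injective
      ext j
      by_cases hj : j = i
      · subst hj; simp
      · simp [hj]
    have := congrArg x h2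
    simp only [map_mul, map_smul, smul_eq_mul] at this
    exact (mul_right_cancel₀ hi this).symm

lemma natCard_point [Finite X] : Nat.card (A →ₐ[k] k) = Nat.card X :=
  (Nat.card_congr (Equiv.ofBijective _ (bijective_eval e))).symm

variable (p : ℕ) [Fact p.Prime]

lemma eq_one_of_pow_eq_one [CharP k p] {a : A} (h : a ^ p = 1) : a = 1 := by
  refine e.injective (funext fun i => ?_)
  have := congrFun (congrArg e h) i
  rw [map_pow, map_one, Pi.pow_apply, Pi.one_apply] at this
  have : (e a i - 1) ^ p = 0 := by rw [sub_pow_char, this]; simp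
  rw [map_one, Pi.one_apply]
  exact sub_eq_zero.1 (pow_eq_zero_iff (Fact.out : p.Prime).ne_zero |>.1 this)

lemma exists_unit_pow_eq [IsAlgClosed k] (u : Aˣ) : ∃ v : Aˣ, v ^ p = u := by
  have hp : 0 < p := (Fact.out : p.Prime).pos
  choose f hf using fun i => IsAlgClosed.exists_pow_nat_eq (e u i) hp
  have h1 : (e.symm f) ^ p = u := by
    apply e.injective
    rw [map_pow, e.apply_symm_apply]
    exact funext hf
  have h2 : IsUnit (e.symm f) := (isUnit_pow_iff hp.ne').1 (h1 ▸ u.isUnit)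
  exact ⟨h2.unit, Units.ext (by simpa using h1)⟩

end Points

/-- An action of an elementary abelian `p`-group `G` on an algebra with `p` points is trivial, or
transitive on points. In the second case all points have the same stabilizer `K`, of index `p`,
since `G` is abelian. -/
lemma action_dichotomy {k A X G : Type*} [Field k] [Ring A] [Algebra k A] (e : A ≃ₐ[k] (X → k))
    (p : ℕ) [Fact p.Prime] (hX : Nat.card X = p) [CommGroup G] [Finite G] (hG : ∀ g : G, g ^ p = 1)
    (α : G →* (A →ₐ[k] A)) : (∀ g a, α g a = a) ∨ ∃ (K : Subgroup G) (x₀ : A →ₐ[k] k),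
      K.index = p ∧ (∀ g ∈ K, ∀ a, α g a = a) ∧ ∀ g, (∀ a, x₀ (α g a) = x₀ a) → g ∈ K := by
  have hp : p.Prime := Fact.out
  have : Finite X := Nat.finite_of_card_ne_zero (hX ▸ hp.ne_zero)
  have hP : Nat.card (A →ₐ[k] k) = p := (natCard_point e).trans hX
  have : Finite (A →ₐ[k] k) := Nat.finite_of_card_ne_zero (hP ▸ hp.ne_zero)
  -- Precomposition is a left action on points because `G` is commutative.
  let act : MulAction G (A →ₐ[k] k) :=
    { smul g x := x.comp (α g)
      one_smul x := by ext a; change x (α 1 a) = x a; simp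
      mul_smul g h x := by
        ext a
        change x (α (g * h) a) = x (α h (α g a))
        rw [mul_comm, map_mul]
        rfl }
  have hsmul (g : G) (x : A →ₐ[k] k) (a : A) : (g • x) a = x (α g a) := rfl
  have hpG : IsPGroup p G := fun g => ⟨1, by simpa using hG g⟩
  by_cases htriv : ∀ x : A →ₐ[k] k, Nat.card (MulAction.orbit G x) = 1
  · refine .inl fun g a => eq_of_forall_point e fun x => ?_
    have := (Nat.card_eq_one_iff_unique.1 (htriv x)).1
    have h1 : (⟨g • x, g, rfl⟩ : MulAction.orbit G x) = ⟨x, MulAction.mem_orbit_self x⟩ :=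
      Subsingleton.elim _ _
    exact DFunLike.congr_fun (congrArg Subtype.val h1) a
  · push Not at htriv
    obtain ⟨x₀, hx₀⟩ := htriv
    have hle : Nat.card (MulAction.orbit G x₀) ≤ p := hP ▸ Nat.card_le_card_of_injective _
      Subtype.val_injective
    have hcard : Nat.card (MulAction.orbit G x₀) = p := by
      obtain ⟨n, hn⟩ := hpG.card_orbit x₀
      have hn0 : n ≠ 0 := by rintro rfl; exact hx₀ (by simpa using hn)
      exact le_antisymm hle (hn ▸ Nat.le_self_pow hn0 p)
    have horb (x : A →ₐ[k] k) : x ∈ MulAction.orbit G x₀ := by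
      have : MulAction.orbit G x₀ = Set.univ :=
        Set.eq_of_subset_of_ncard_le (Set.subset_univ _) (by
          rw [Set.ncard_univ, hP, ← Nat.card_coe_set_eq, hcard])
      rw [this]; trivial
    refine .inr ⟨MulAction.stabilizer G x₀, x₀, ?_, fun g hg a => ?_, fun g hg => ?_⟩
    · rw [MulAction.index_stabilizer, ← Nat.card_coe_set_eq, hcard]
    · refine eq_of_forall_point e fun x => ?_
      obtain ⟨h, rfl⟩ := horb x
      change (g • h • x₀) a = (h • x₀) a
      rw [smul_smul, mul_comm, ← smul_smul, MulAction.mem_stabilizer_iff.1 hg]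
    · exact MulAction.mem_stabilizer_iff.2 (AlgHom.ext hg)

/-- The dual of a group algebra is the algebra of functions on the group. -/
def dualEquiv (k D : Type*) [Field k] [Group D] :
    DualAlg k (MonoidAlgebra k D) ≃ₐ[k] (D → k) :=
  AlgEquiv.ofLinearEquiv
    { toFun f d := f.ofConv (MonoidAlgebra.single d 1)
      map_add' f f' := rfl
      map_smul' c f := rfl
      invFun f := WithConv.toConv
        (Finsupp.linearCombination k f ∘ₗ (MonoidAlgebra.coeffLinearEquiv k).toLinearMap)
      left_inv f := by
        ext d
        simp
      right_inv f := by
        ext d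
        simp }
    (by
      ext d
      change (1 : DualAlg k (MonoidAlgebra k D)).ofConv (MonoidAlgebra.single d 1) = 1
      simp [LinearMap.convOne_def])
    (fun f f' => by
      ext d
      change (f * f').ofConv (MonoidAlgebra.single d 1) = f.ofConv _ * f'.ofConv _
      simp)

lemma dualEquiv_apply {k D : Type*} [Field k] [Group D] (f : DualAlg k (MonoidAlgebra k D))
    (d : D) : dualEquiv k D f d = f.ofConv (MonoidAlgebra.single d 1) := rfl

lemma dualEquiv_harpoon {k D : Type*} [Field k] [Group D] (f : DualAlg k (MonoidAlgebra k D))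
    (c d : D) : dualEquiv k D ((harpoon k (MonoidAlgebra k D)).act (MonoidAlgebra.single c 1) f) d =
      dualEquiv k D f (d * c) := by
  simp [dualEquiv_apply, harpoon]

/-- Let `D` have as many elements as `A` has points, and let no `d ≠ 1` fix the point `x₀`. Then `D`
permutes the points of `A` simply transitively. The base point `x₀` identifies `A` with
the functions on `D`, and the action of `D` with `⇀`. -/
lemma exists_dual_equiv {k A X D : Type*} [Field k] [Ring A] [Algebra k A] [Finite X]
    (e : A ≃ₐ[k] (X → k)) [Group D] (hD : Nat.card D = Nat.card X) (α : D →* (A →ₐ[k] A))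
    (x₀ : A →ₐ[k] k) (hα : ∀ d, (∀ a, x₀ (α d a) = x₀ a) → d = 1) :
    (∀ x : A →ₐ[k] k, ∃ d, ∀ a, x a = x₀ (α d a)) ∧
    ∃ ψ : A ≃ₐ[k] DualAlg k (MonoidAlgebra k D), ∀ d a, ψ (α d a) =
      (harpoon k (MonoidAlgebra k D)).act (MonoidAlgebra.single d 1) (ψ a) := by
  have hXpos : Nat.card X ≠ 0 := by
    obtain ⟨i, -⟩ := (bijective_eval e).2 x₀
    exact Nat.card_ne_zero.2 ⟨⟨i⟩, inferInstance⟩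
  have : Finite D := Nat.finite_of_card_ne_zero (hD ▸ hXpos)
  have hP : Nat.card (A →ₐ[k] k) = Nat.card X := natCard_point e
  have : Finite (A →ₐ[k] k) := Nat.finite_of_card_ne_zero (hP ▸ hXpos)
  have hinj : Function.Injective fun d => x₀.comp (α d) := by
    intro c d hcd
    have h (a : A) : x₀ (α c a) = x₀ (α d a) := DFunLike.congr_fun hcd a
    refine mul_inv_eq_one.1 (hα _ fun a => ?_)
    have h1 : α (c * d⁻¹) a = α c (α d⁻¹ a) := by rw [map_mul]; rfl
    have h2 : α d (α d⁻¹ a) = a := by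
      have : α d (α d⁻¹ a) = α (d * d⁻¹) a := by rw [map_mul]; rfl
      simp [this]
    rw [h1, h, h2]
  have hsurj : Function.Surjective fun d => x₀.comp (α d) :=
    ((Nat.bijective_iff_injective_and_card _).2 ⟨hinj, hD.trans hP.symm⟩).2
  have hpt (x : A →ₐ[k] k) : ∃ d, ∀ a, x a = x₀ (α d a) := by
    obtain ⟨d, rfl⟩ := hsurj x
    exact ⟨d, fun a => rfl⟩
  refine ⟨hpt, ?_⟩
  let Ψ : A →ₐ[k] (D → k) := AlgHom.pi fun d => x₀.comp (α d)
  have hΨ (a : A) (d : D) : Ψ a d = x₀ (α d a) := rfl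
  have hΨinj : Function.Injective Ψ := fun a b hab => eq_of_forall_point e fun x => by
    obtain ⟨d, hd⟩ := hpt x
    rw [hd, hd, ← hΨ, hab, hΨ]
  have := Fintype.ofFinite X
  have := Fintype.ofFinite D
  have : FiniteDimensional k A := Module.Finite.equiv e.symm.toLinearEquiv
  have hfin : Module.finrank k A = Module.finrank k (D → k) := by
    rw [e.toLinearEquiv.finrank_eq]
    simp only [Module.finrank_fintype_fun_eq_card]
    simpa [Nat.card_eq_fintype_card] using hD.symm
  have hΨbij : Function.Bijective Ψ := ⟨hΨinj,
    (LinearMap.injective_iff_surjective_of_finrank_eq_finrank hfin (f := Ψ.toLinearMap)).1 hΨinj⟩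
  refine ⟨(AlgEquiv.ofBijective Ψ hΨbij).trans (dualEquiv k D).symm, fun d a => ?_⟩
  apply (dualEquiv k D).injective
  ext c
  rw [dualEquiv_harpoon]
  simp only [AlgEquiv.trans_apply, AlgEquiv.apply_symm_apply, AlgEquiv.coe_ofBijective, hΨ,
    map_mul]
  rfl

/-! ### Lifting group elements to units -/

namespace ExtData

variable {k A B : Type*} [Field k] [Ring A] [Algebra k A] [Ring B] [Algebra k B]

/-- For a commutative base `A` the conjugation by a unit of degree `g` depends only on `g`, so that
`G` acts on `A`: every element `b` of degree `g` satisfies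
`b a = (g · a) b`. -/
lemma IsCleft.exists_action {G : Type*} [Group G] {E : ExtData k A (MonoidAlgebra k G) B}
    (hE : E.IsCleft) (hcomm : ∀ a b : A, a * b = b * a) :
    ∃ α : G →* (A →ₐ[k] A), ∀ g b a, E.IsHomog g b → b * E.incl a = E.incl (α g a) * b := by
  choose u hu using hE.exists_unit
  have hex (g : G) (a : A) : ∃ a', E.incl a' = u g * E.incl a * ((u g)⁻¹ : Bˣ) :=
    hE.exists_incl_eq (by simpa using ((hu g).mul (hE.isHomog_incl a)).mul (hu g).inv)
  choose f hf using hex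
  have key (g : G) (b : B) (a : A) (hb : E.IsHomog g b) :
      b * E.incl a = E.incl (f g a) * b := by
    obtain ⟨c, rfl⟩ := hE.exists_incl_mul_eq (hu g) hb
    have h1 : E.incl (f g a) * E.incl c = E.incl c * E.incl (f g a) := by
      rw [← map_mul, hcomm, map_mul]
    rw [← mul_assoc, h1, hf]
    simp [mul_assoc]
  have huniq (g : G) (w : Bˣ) (hw : E.IsHomog g (w : B)) (a a' : A)
      (h : w * E.incl a = E.incl a' * w) : a' = f g a := by
    apply hE.incl_injective
    rw [← Units.mul_left_inj w, ← h, key g w a hw]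
  refine ⟨⟨⟨fun g => ⟨⟨⟨⟨f g, ?_⟩, ?_⟩, ?_, ?_⟩, ?_⟩, ?_⟩, ?_⟩, key⟩
  · exact (huniq g _ (hu g) _ _ (by simp)).symm
  · exact fun a b => (huniq g _ (hu g) _ _ (by
      rw [map_mul, map_mul, ← mul_assoc, key g _ a (hu g), mul_assoc, key g _ b (hu g),
        mul_assoc])).symm
  · exact (huniq g _ (hu g) _ _ (by simp)).symm
  · exact fun a b => (huniq g _ (hu g) _ _ (by
      rw [map_add, map_add, mul_add, key g _ a (hu g), key g _ b (hu g), add_mul])).symm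
  · exact fun r => (huniq g _ (hu g) _ _ (by simp [Algebra.commutes])).symm
  · refine AlgHom.ext fun a => ?_
    exact (huniq 1 1 (by simpa using isHomog_one) _ _ (by simp)).symm
  · intro g h
    refine AlgHom.ext fun a => ?_
    refine (huniq (g * h) (u g * u h) (by simpa using (hu g).mul (hu h)) _ _ ?_).symm
    change _ = E.incl (f g (f h a)) * _
    rw [Units.val_mul, mul_assoc, key h _ a (hu h), ← mul_assoc, key g _ _ (hu g), mul_assoc]

section Lifts

variable {G : Type*} [CommGroup G] {E : ExtData k A (MonoidAlgebra k G) B} (hE : E.IsCleft)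
  {p : ℕ} [Fact p.Prime] {α : G →* (A →ₐ[k] A)}
  (hα : ∀ g b a, E.IsHomog g b → b * E.incl a = E.incl (α g a) * b)
include hE hα

/-- If only scalars are fixed by `c`, then `c` has a lift of order `p`: the `p`-th power of any
lift is a scalar. -/
lemma exists_lift_of_fixed_scalar [IsAlgClosed k] (hG : ∀ g : G, g ^ p = 1) (c : G)
    (hc : ∀ a, α c a = a → ∃ r : k, a = algebraMap k A r) :
    ∃ u : Bˣ, E.IsHomog c (u : B) ∧ u ^ p = 1 := by
  have hp : p.Prime := Fact.out
  obtain ⟨u, hu⟩ := hE.exists_unit c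
  rcases subsingleton_or_nontrivial B with hB | hB
  · exact ⟨u, hu, Subsingleton.elim _ _⟩
  -- The element `u ^ p` has degree `c ^ p = 1`, and `c` fixes it as it commutes with `u`.
  obtain ⟨a, ha⟩ := hE.exists_incl_eq (b := (u : B) ^ p) (by simpa [hG] using hu.pow p)
  obtain ⟨r, rfl⟩ := hc a (by
    apply hE.incl_injective
    rw [← Units.mul_left_inj u, ← hα c u a hu, ha, pow_mul_comm'])
  rw [AlgHom.commutes] at ha
  obtain ⟨s, rfl⟩ := IsAlgClosed.exists_pow_nat_eq r hp.pos
  have hs : s ≠ 0 := by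
    rintro rfl
    rw [zero_pow hp.ne_zero, map_zero, ← Units.val_pow_eq_pow_val] at ha
    exact (u ^ p).ne_zero ha.symm
  let t : Bˣ := Units.map (algebraMap k B : k →* B) (Units.mk0 s hs)
  have ht : (t : B) = algebraMap k B s := rfl
  have hcomm : Commute t u := Units.ext (Algebra.commutes s (u : B))
  refine ⟨t⁻¹ * u, ?_, ?_⟩
  · have h1 : E.IsHomog 1 (t : B) := by
      have := hE.isHomog_incl (algebraMap k A s)
      rwa [AlgHom.commutes] at this
    simpa using h1.inv.mul hu
  · have : t ^ p = u ^ p := Units.ext (by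
      rw [Units.val_pow_eq_pow_val, Units.val_pow_eq_pow_val, ht, ← map_pow, ha])
    rw [hcomm.inv_left.mul_pow, inv_pow, this, inv_mul_cancel]

variable {X : Type*} (e : A ≃ₐ[k] (X → k))
include e

/-- As `A` is reduced of characteristic `p`, a group element acting trivially on `A` has at most
one lift of order `p`. -/
lemma eq_of_pow_eq_one [CharP k p] {g : G} (hg : ∀ a, α g a = a) {u w : Bˣ}
    (hu : E.IsHomog g (u : B)) (hw : E.IsHomog g (w : B)) (hup : u ^ p = 1) (hwp : w ^ p = 1) :
    u = w := by
  obtain ⟨a, ha⟩ := hE.exists_incl_mul_eq hu hw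
  have hcomm : Commute (E.incl a) (u : B) := by
    have := hα g u a hu
    rw [hg] at this
    exact this.symm
  have h1 : E.incl (a ^ p) = E.incl 1 := by
    have h2 : (E.incl a * u) ^ p = 1 := by
      rw [ha, ← Units.val_pow_eq_pow_val, hwp, Units.val_one]
    rw [hcomm.mul_pow, ← Units.val_pow_eq_pow_val, hup, Units.val_one, mul_one] at h2
    rw [map_pow, h2, map_one]
  have h2 := eq_one_of_pow_eq_one e p (hE.incl_injective h1)
  rw [h2, map_one, one_mul] at ha
  exact Units.ext ha

/-- By uniqueness, the lift of order `p` is unchanged under conjugation by homogeneous units. -/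
lemma commute_of_pow_eq_one [CharP k p] {g h : G} (hg : ∀ a, α g a = a) {u w : Bˣ}
    (hu : E.IsHomog g (u : B)) (hw : E.IsHomog h (w : B)) (hup : u ^ p = 1) : Commute w u := by
  have h1 : E.IsHomog g ((w * u * w⁻¹ : Bˣ) : B) := by
    have := (hw.mul hu).mul hw.inv
    rw [mul_inv_cancel_comm] at this
    exact this
  have h2 := eq_of_pow_eq_one hE hα e hg h1 hu (by rw [conj_pow, hup]; simp) hup
  exact mul_inv_eq_iff_eq_mul.1 h2

/-- The elements acting trivially on `A` lift to a group of units of `B`: the lifts of order `p`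
exist because units of `A` have `p`-th roots, and they are closed under products because they
are unique. -/
lemma exists_lift_of_trivial [CharP k p] [IsAlgClosed k] (hG : ∀ g : G, g ^ p = 1)
    (K : Subgroup G) (hK : ∀ g ∈ K, ∀ a, α g a = a) :
    ∃ v : K →* Bˣ, ∀ g : K, E.IsHomog (g : G) (v g : B) ∧ v g ^ p = 1 := by
  have hex (g : K) : ∃ u : Bˣ, E.IsHomog (g : G) (u : B) ∧ u ^ p = 1 := by
    obtain ⟨u, hu⟩ := hE.exists_unit (g : G)
    -- Divide `u` by a `p`-th root of the unit `u ^ p` of the base.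
    have hup : E.IsHomog 1 ((u ^ p : Bˣ) : B) := by simpa [hG] using hu.pow p
    have hupi : E.IsHomog 1 (((u ^ p)⁻¹ : Bˣ) : B) := by simpa using hup.inv
    obtain ⟨a, ha⟩ := hE.exists_incl_eq hup
    obtain ⟨b, hb⟩ := hE.exists_incl_eq hupi
    obtain ⟨w, hw⟩ := exists_unit_pow_eq e p
      ⟨a, b, hE.incl_injective (by
        rw [map_mul, map_one, ha, hb]; exact Units.mul_inv _),
        hE.incl_injective (by
        rw [map_mul, map_one, ha, hb]; exact Units.inv_mul _)⟩
    have hw' : Units.map (E.incl : A →* B) w ^ p = u ^ p := by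
      rw [← map_pow, hw]
      exact Units.ext ha
    have hcomm : Commute (Units.map (E.incl : A →* B) w) u := by
      have := hα g u w hu
      rw [hK g g.2] at this
      exact Units.ext this.symm
    refine ⟨(Units.map (E.incl : A →* B) w)⁻¹ * u, ?_, ?_⟩
    · have h1 : E.IsHomog 1 (Units.map (E.incl : A →* B) w : B) := hE.isHomog_incl _
      simpa using h1.inv.mul hu
    · rw [hcomm.inv_left.mul_pow, inv_pow, hw', inv_mul_cancel]
  choose v hv hvp using hex
  have hcomm (g h : K) : Commute (v g) (v h) :=
    commute_of_pow_eq_one hE hα e (hK h h.2) (hv h) (hv g) (hvp h)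
  refine ⟨MonoidHom.mk' v fun g h => ?_, fun g => ⟨hv g, hvp g⟩⟩
  refine eq_of_pow_eq_one hE hα e (hK _ (g * h).2) (hv _) ?_ (hvp _) ?_
  · simpa using (hv g).mul (hv h)
  · rw [(hcomm g h).mul_pow, hvp, hvp, one_mul]

/-- Let `D` be a group of order `p` that is mapped to `G` and acts freely on the orbit of the point
`x₀`. Then it acts simply transitively on all `p` points, so `A` is the dual of `k[D]` as a module
algebra, and `D` lifts to a group of units of `B`. -/
lemma exists_lift_of_transitive [CharP k p] [IsAlgClosed k] [Finite X] (hX : Nat.card X = p)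
    (hG : ∀ g : G, g ^ p = 1) {D : Type*} [Group D] (hD : Nat.card D = p) (j : D →* G)
    (x₀ : A →ₐ[k] k) (hx₀ : ∀ d, (∀ a, x₀ (α (j d) a) = x₀ a) → d = 1) :
    ∃ (v : D →* Bˣ) (ψ : A ≃ₐ[k] DualAlg k (MonoidAlgebra k D)),
      (∀ d, E.IsHomog (j d) (v d : B)) ∧
      ∀ d a, ψ (α (j d) a) =
        (harpoon k (MonoidAlgebra k D)).act (MonoidAlgebra.single d 1) (ψ a) := by
  have hp : p.Prime := Fact.out
  obtain ⟨hpt, ψ, hψ⟩ := exists_dual_equiv e (hD.trans hX.symm) (α.comp j) x₀ hx₀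
  have : IsCyclic D := isCyclic_of_prime_card hD
  obtain ⟨d, hd⟩ := IsCyclic.exists_generator (α := D)
  have hord : orderOf d = p := by rw [orderOf_eq_card_of_forall_mem_zpowers hd, hD]
  obtain ⟨u, hu, hup⟩ := exists_lift_of_fixed_scalar hE hα hG (j d) fun a ha => by
    -- An element fixed by the generator `d` is fixed by `D`, hence takes the same value at all
    -- points.
    have hfix : ∀ c, α (j c) a = a := by
      let S : Subgroup D :=
        { carrier := {c | α (j c) a = a}
          one_mem' := by simp
          mul_mem' := fun {x y} hx hy => by
            change α (j (x * y)) a = a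
            rw [map_mul, map_mul, AlgHom.mul_apply, hy, hx]
          inv_mem' := fun {x} hx => by
            change α (j x⁻¹) a = a
            have hx' : α (j x) a = a := hx
            nth_rw 1 [← hx']
            rw [← AlgHom.mul_apply, ← map_mul, ← map_mul, inv_mul_cancel]
            simp }
      exact fun c => (Subgroup.zpowers_le (H := S)).2 ha (hd c)
    refine ⟨x₀ a, eq_of_forall_point e fun x => ?_⟩
    obtain ⟨c, hc⟩ := hpt x
    have : x a = x₀ (α (j c) a) := hc a
    rw [this, hfix]
    simp
  refine ⟨monoidHomOfForallMemZpowers hd (g' := u)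
    (hord ▸ orderOf_dvd_of_pow_eq_one hup), ψ, fun c => ?_, hψ⟩
  obtain ⟨n, rfl⟩ := hd c
  simp only [map_zpow, monoidHomOfForallMemZpowers_apply_gen]
  exact hu.zpow n

end Lifts

end ExtData

/-! ### Homomorphisms from smash products with group algebras -/

namespace SmashProduct

section Lift

variable {k A G : Type*} [Field k] [Ring A] [Algebra k A] [Group G]
  (M : ModuleAlgebra k (MonoidAlgebra k G) A)

lemma mk_single_mul_mk (a b : A) (g : G) (h : MonoidAlgebra k G) :
    mk M a (MonoidAlgebra.single g 1) * mk M b h =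
      mk M (a * M.act (MonoidAlgebra.single g 1) b) (MonoidAlgebra.single g 1 * h) := by
  change mulAux M (a ⊗ₜ _) (b ⊗ₜ h) =
    (a * M.act (MonoidAlgebra.single g 1) b) ⊗ₜ[k] (MonoidAlgebra.single g 1 * h)
  rw [mulAux_tmul]
  simp [ModuleAlgebra.twist]

lemma incl_apply (a : A) : incl M a = mk M a 1 := rfl

lemma span_mk (x : SmashProduct M) :
    x ∈ Submodule.span k {x | ∃ a g, x = mk M a (MonoidAlgebra.single g 1)} := by
  induction x using mk_induction with
  | zero => exact zero_mem _
  | add x y hx hy => exact add_mem hx hy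
  | mk a h =>
    induction h using MonoidAlgebra.induction_linear with
    | zero =>
      rw [show mk M a 0 = 0 from TensorProduct.tmul_zero _ _]
      exact zero_mem _
    | add x y hx hy =>
      rw [show mk M a (x + y) = mk M a x + mk M a y from TensorProduct.tmul_add _ _ _]
      exact add_mem hx hy
    | single g r =>
      have h1 : mk M a (MonoidAlgebra.single g r) = r • mk M a (MonoidAlgebra.single g 1) := by
        have : MonoidAlgebra.single g r = r • MonoidAlgebra.single g (1 : k) := by simp
        rw [this]
        exact TensorProduct.tmul_smul _ _ _
      rw [h1]
      exact Submodule.smul_mem _ _ (Submodule.subset_span ⟨a, g, rfl⟩)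

/-- The homomorphism `g ↦ 1 # g` from `G` to the units of `A # k[G]`. -/
def unitHom : G →* (SmashProduct M)ˣ :=
  MonoidHom.toHomUnits
    { toFun g := mk M 1 (MonoidAlgebra.single g 1)
      map_one' := rfl
      map_mul' g h := by
        rw [mk_single_mul_mk, M.act_one]
        simp }

lemma unitHom_apply (g : G) :
    (unitHom M g : SmashProduct M) = mk M 1 (MonoidAlgebra.single g 1) := rfl

lemma incl_mul_unitHom (a : A) (g : G) :
    incl M a * (unitHom M g : SmashProduct M) = mk M a (MonoidAlgebra.single g 1) := by
  rw [incl_apply, unitHom_apply, MonoidAlgebra.one_def, mk_single_mul_mk, ← MonoidAlgebra.one_def,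
    M.one_act]
  simp

variable {M} {B : Type*} [Ring B] [Algebra k B] (φ : A →ₐ[k] B) (v : G →* B)
  (h : ∀ g a, v g * φ a = φ (M.act (MonoidAlgebra.single g 1) a) * v g)

/-- The underlying linear map of `SmashProduct.lift`. -/
def liftLin : SmashProduct M →ₗ[k] B :=
  (LinearMap.mul' k B ∘ₗ TensorProduct.map φ.toLinearMap (MonoidAlgebra.lift k B G v).toLinearMap :
    A ⊗[k] MonoidAlgebra k G →ₗ[k] B)

lemma liftLin_mk (a : A) (g : G) :
    liftLin (M := M) φ v (mk M a (MonoidAlgebra.single g 1)) = φ a * v g := by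
  change LinearMap.mul' k B (TensorProduct.map _ _ (a ⊗ₜ _)) = _
  simp

/-- The algebra homomorphism `A # k[G] → B`, `a # g ↦ φ(a) v(g)`, for a pair of homomorphisms that
satisfies the commutation rule of the smash product. -/
def lift : SmashProduct M →ₐ[k] B :=
  AlgHom.ofLinearMap (liftLin φ v)
    (by
      have := liftLin_mk (M := M) φ v 1 1
      rw [map_one, map_one, mul_one] at this
      exact this)
    (fun x y => by
      induction span_mk M x using Submodule.span_induction with
      | zero => simp
      | add x x' _ _ hx hx' => rw [add_mul, map_add, map_add, add_mul, hx, hx']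
      | smul r x _ hx => rw [smul_mul_assoc, map_smul, map_smul, smul_mul_assoc, hx]
      | mem x hx =>
        obtain ⟨a, g, rfl⟩ := hx
        induction span_mk M y using Submodule.span_induction with
        | zero => simp
        | add x x' _ _ hx hx' => rw [mul_add, map_add, map_add, mul_add, hx, hx']
        | smul r x _ hx => rw [mul_smul_comm, map_smul, map_smul, mul_smul_comm, hx]
        | mem y hy =>
          obtain ⟨b, g', rfl⟩ := hy
          rw [mk_single_mul_mk, MonoidAlgebra.single_mul_single, one_mul, liftLin_mk, liftLin_mk,
            liftLin_mk, map_mul, map_mul, mul_assoc, mul_assoc, ← mul_assoc (v g), h, mul_assoc])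

lemma lift_mk (a : A) (g : G) :
    lift φ v h (mk M a (MonoidAlgebra.single g 1)) = φ a * v g := liftLin_mk (M := M) φ v a g

lemma lift_incl (a : A) : lift φ v h (incl M a) = φ a := by
  have := lift_mk φ v h a 1
  rwa [map_one, mul_one] at this

lemma lift_unitHom (g : G) : lift φ v h (unitHom M g : SmashProduct M) = v g := by
  rw [unitHom_apply, lift_mk, map_one, one_mul]

end Lift

end SmashProduct

/-! ### The models are cleft extensions -/

namespace ExtData

section Models

variable {k A G : Type*} [Field k] [Ring A] [Algebra k A] [Group G]

lemma IsCleft.rebase {A' B : Type*} [Ring A'] [Algebra k A'] [Ring B] [Algebra k B]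
    {E : ExtData k A (MonoidAlgebra k G) B} (hE : E.IsCleft) (ι : A' ≃ₐ[k] A) :
    (E.rebase ι).IsCleft where
  coassoc := hE.coassoc
  counit := hE.counit
  incl_injective := hE.incl_injective.comp ι.injective
  mem_range_incl b := by
    rw [← show _ ↔ (E.rebase ι).coact b = _ from hE.mem_range_incl b]
    constructor
    · rintro ⟨a, rfl⟩
      exact ⟨ι a, rfl⟩
    · rintro ⟨a, rfl⟩
      exact ⟨ι.symm a, congrArg E.incl (ι.apply_symm_apply a)⟩
  exists_cleft := hE.exists_cleft

/-- The homomorphism `g ↦ 1 ⊗ g` from `G` to the units of `B ⊗ k[G]`. -/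
def tensorUnitHom (k B G : Type*) [Field k] [Ring B] [Algebra k B] [Group G] :
    G →* (B ⊗[k] MonoidAlgebra k G)ˣ :=
  MonoidHom.toHomUnits (((Algebra.TensorProduct.includeRight :
    MonoidAlgebra k G →ₐ[k] B ⊗[k] MonoidAlgebra k G) : MonoidAlgebra k G →* _).comp
      (MonoidAlgebra.of k G))

lemma tensorUnitHom_apply (B : Type*) [Ring B] [Algebra k B] (g : G) :
    (tensorUnitHom k B G g : B ⊗[k] MonoidAlgebra k G) =
      (1 : B) ⊗ₜ[k] MonoidAlgebra.single g (1 : k) := rfl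

/-- The tensors `b ⊗ g` span `B ⊗ k[G]`. -/
lemma tmul_single_induction {B : Type*} [AddCommGroup B] [Module k B]
    {P : Submodule k (B ⊗[k] MonoidAlgebra k G)}
    (h : ∀ b g, b ⊗ₜ[k] MonoidAlgebra.single g (1 : k) ∈ P) (x : B ⊗[k] MonoidAlgebra k G) :
    x ∈ P := by
  induction x with
  | zero => exact zero_mem _
  | add x y hx hy => exact add_mem hx hy
  | tmul b y =>
    induction y using MonoidAlgebra.induction_linear with
    | zero => simp
    | add x y hx hy => rw [TensorProduct.tmul_add]; exact add_mem hx hy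
    | single g r =>
      have : MonoidAlgebra.single g r = r • MonoidAlgebra.single g (1 : k) := by simp
      rw [this, TensorProduct.tmul_smul]
      exact Submodule.smul_mem _ _ (h b g)

lemma isHomog_tensorUnitHom (g : G) : (ExtData.tensor k A (MonoidAlgebra k G)).IsHomog g
    (tensorUnitHom k A G g : A ⊗[k] MonoidAlgebra k G) := by
  rw [tensorUnitHom_apply]
  simp [IsHomog, ExtData.tensor]

lemma isCleft_tensor [Finite G] : (ExtData.tensor k A (MonoidAlgebra k G)).IsCleft := by
  refine isCleft_of_units ?_ (fun a => ?_) (tensorUnitHom k A G) isHomog_tensorUnitHom (map_one _) ?_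
  · exact Algebra.TensorProduct.includeLeft_injective
      (FaithfulSMul.algebraMap_injective k (MonoidAlgebra k G))
  · simp [IsHomog, ExtData.tensor, MonoidAlgebra.one_def]
  · refine tmul_single_induction fun b g => Submodule.subset_span ⟨b, g, ?_⟩
    simp [ExtData.tensor, tensorUnitHom_apply]

section Smash

variable (M : ModuleAlgebra k (MonoidAlgebra k G) A)

lemma smash_coact_mk (a : A) (g : G) :
    (smash M).coact (SmashProduct.mk M a (MonoidAlgebra.single g 1)) =
      SmashProduct.mk M a (MonoidAlgebra.single g 1) ⊗ₜ[k] MonoidAlgebra.single g 1 := by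
  change (TensorProduct.assoc k A _ _).symm
    (Coalgebra.comul.lTensor A (a ⊗ₜ[k] (MonoidAlgebra.single g (1 : k)))) = _
  simp
  rfl

lemma isHomog_unitHom (g : G) :
    (smash M).IsHomog g (SmashProduct.unitHom M g : SmashProduct M) :=
  smash_coact_mk M 1 g

lemma smash_incl_injective : Function.Injective (smash M).incl :=
  Algebra.TensorProduct.includeLeft_injective (R := k) (S := k) (A := A)
    (B := MonoidAlgebra k G) (FaithfulSMul.algebraMap_injective k (MonoidAlgebra k G))

lemma isHomog_smash_incl (a : A) : (smash M).IsHomog 1 ((smash M).incl a) :=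
  smash_coact_mk M a 1

lemma isCleft_smash [Finite G] : (smash M).IsCleft := by
  refine isCleft_of_units (smash_incl_injective M) (isHomog_smash_incl M) (SmashProduct.unitHom M)
    (isHomog_unitHom M) (map_one _) fun x => ?_
  refine Submodule.span_mono ?_ (SmashProduct.span_mk M x)
  rintro _ ⟨a, g, rfl⟩
  exact ⟨a, g, (SmashProduct.incl_mul_unitHom M a g).symm⟩

end Smash

end Models

section HeisenbergTensor

/-- The homomorphism `(c, g) ↦ (1 # c) ⊗ g` to the units of `𝓗(k[C]^*) ⊗ k[K]`. -/
def heisenbergTensorUnitHom (k : Type*) {C K : Type*} [Field k] [Group C] [Group K] :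
    C × K →* (HeisenbergDouble k (MonoidAlgebra k C) ⊗[k] MonoidAlgebra k K)ˣ :=
  MonoidHom.toHomUnits
    { toFun x := (SmashProduct.unitHom (harpoon k (MonoidAlgebra k C)) x.1 : SmashProduct _) ⊗ₜ[k]
        MonoidAlgebra.single x.2 1
      map_one' := by simp [Algebra.TensorProduct.one_def, MonoidAlgebra.one_def]
      map_mul' x y := by simp }

lemma heisenbergTensorUnitHom_apply {k C K : Type*} [Field k] [Group C] [Group K] (x : C × K) :
    (heisenbergTensorUnitHom k x : HeisenbergDouble k (MonoidAlgebra k C) ⊗[k] MonoidAlgebra k K) =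
      (SmashProduct.unitHom (harpoon k (MonoidAlgebra k C)) x.1 :
        HeisenbergDouble k (MonoidAlgebra k C)) ⊗ₜ[k] MonoidAlgebra.single x.2 1 := rfl

variable {k A G : Type*} [Field k] [CommGroup G] [Ring A] [Algebra k A] {C K : Subgroup G} (ι : A ≃ₐ[k] DualAlg k (MonoidAlgebra k C))

lemma heisenbergTensor_incl (a : A) : (heisenbergTensor k C K ι).incl a =
    (smash (harpoon k (MonoidAlgebra k C))).incl (ι a) ⊗ₜ[k] (1 : MonoidAlgebra k K) := rfl

lemma isHomog_heisenbergTensor_tmul (x : HeisenbergDouble k (MonoidAlgebra k C)) (c : C) (g : K)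
    (hx : (heisenberg k (MonoidAlgebra k C)).IsHomog c x) :
    (heisenbergTensor k C K ι).IsHomog (c * g : G) (x ⊗ₜ[k] MonoidAlgebra.single g (1 : k)) := by
  unfold IsHomog at *
  simp [heisenbergTensor, rebase, tensorHopf, hx]

lemma isHomog_heisenbergTensorUnitHom (x : C × K) :
    (heisenbergTensor k C K ι).IsHomog (x.1 * x.2 : G) (heisenbergTensorUnitHom k x :
      HeisenbergDouble k (MonoidAlgebra k C) ⊗[k] MonoidAlgebra k K) := by
  rw [heisenbergTensorUnitHom_apply]
  exact isHomog_heisenbergTensor_tmul ι _ _ _ (isHomog_unitHom _ _)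

/-- `C × K ≃ G` for complementary subgroups `C` and `K` of a commutative group. -/
lemma exists_mulEquiv_of_isCompl (h : IsCompl C K) :
    ∃ f : C × K ≃* G, ∀ x, f x = (x.1 * x.2 : G) := by
  refine ⟨MulEquiv.ofBijective (MonoidHom.coprod C.subtype K.subtype) ⟨?_, fun g => ?_⟩,
    fun x => rfl⟩
  · rw [injective_iff_map_eq_one]
    rintro ⟨c, g⟩ hcg
    have h1 : (c : G) * g = 1 := hcg
    have h2 : (c : G) ∈ K := by rw [mul_eq_one_iff_eq_inv.1 h1]; exact K.inv_mem g.2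
    have h3 : (c : G) = 1 := Subgroup.disjoint_def.1 h.disjoint c.2 h2
    rw [h3, one_mul] at h1
    exact Prod.ext (Subtype.ext h3) (Subtype.ext h1)
  · obtain ⟨c, hc, d, hd, rfl⟩ := Subgroup.mem_sup.1 (h.sup_eq_top ▸ Subgroup.mem_top g)
    exact ⟨(⟨c, hc⟩, ⟨d, hd⟩), rfl⟩

lemma isCleft_heisenbergTensor [Finite G] (h : IsCompl C K) :
    (heisenbergTensor k C K ι).IsCleft := by
  obtain ⟨f, hf⟩ := exists_mulEquiv_of_isCompl h
  have hf' (g : G) : ((f.symm g).1 * (f.symm g).2 : G) = g := by rw [← hf, f.apply_symm_apply]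
  refine isCleft_of_units ?_ (fun a => ?_)
    ((heisenbergTensorUnitHom k).comp f.symm.toMonoidHom) (fun g => ?_) (map_one _) ?_
  · have h1 : Function.Injective (Algebra.TensorProduct.includeLeft :
        HeisenbergDouble k (MonoidAlgebra k C) →ₐ[k] _ ⊗[k] MonoidAlgebra k K) :=
      Algebra.TensorProduct.includeLeft_injective
        (FaithfulSMul.algebraMap_injective k (MonoidAlgebra k K))
    exact fun a b hab => ι.injective (smash_incl_injective _ (h1 hab))
  · rw [heisenbergTensor_incl]
    simpa [MonoidAlgebra.one_def] using isHomog_heisenbergTensor_tmul (K := K) ι _ 1 1 (isHomog_smash_incl _ (ι a))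
  · simpa [hf'] using isHomog_heisenbergTensorUnitHom ι (f.symm g)
  · refine tmul_single_induction fun b g => ?_
    induction SmashProduct.span_mk _ b using Submodule.span_induction with
    | zero => simp
    | add x y _ _ hx hy => rw [TensorProduct.add_tmul]; exact add_mem hx hy
    | smul r x _ hx => rw [← TensorProduct.smul_tmul']; exact Submodule.smul_mem _ _ hx
    | mem x hx =>
      obtain ⟨a, c, rfl⟩ := hx
      refine Submodule.subset_span ⟨ι.symm a, f (c, g), ?_⟩
      have h1 : ((heisenbergTensorUnitHom k).comp f.symm.toMonoidHom) (f (c, g)) =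
          heisenbergTensorUnitHom k (c, g) := by simp
      rw [h1, heisenbergTensor_incl, heisenbergTensorUnitHom_apply, ι.apply_symm_apply,
        Algebra.TensorProduct.tmul_mul_tmul, MonoidAlgebra.one_def,
        MonoidAlgebra.single_mul_single, one_mul, one_mul]
      exact congrArg (· ⊗ₜ[k] _) (SmashProduct.incl_mul_unitHom _ a c).symm

end HeisenbergTensor

/-- Twist equivalent extensions have isomorphic algebras, so commutativity is shared. -/
lemma TwistEquiv.mul_comm {k A H B B' : Type*} [Field k] [Ring A] [Algebra k A] [Ring H]
    [HopfAlgebra k H] [Ring B] [Algebra k B] [Ring B'] [Algebra k B'] {E : ExtData k A H B}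
    {E' : ExtData k A H B'} (h : E.TwistEquiv E') (hB : ∀ x y : B, x * y = y * x) (x y : B') :
    x * y = y * x := by
  obtain ⟨-, -, f, -, -⟩ := h
  apply f.symm.injective
  rw [map_mul, map_mul, hB]

end ExtData

/-! ### Commutativity, and the algebra `k[x]/(x ^ p - x)` -/

lemma heisenberg_not_comm {k D : Type*} [Field k] [Group D] [Nontrivial D] :
    ∃ x y : HeisenbergDouble k (MonoidAlgebra k D), x * y ≠ y * x := by
  classical
  -- For `c ≠ 1` the functions `δ₁` and `c ⇀ δ₁` differ at `1`.
  obtain ⟨c, hc⟩ := exists_ne (1 : D)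
  let M := harpoon k (MonoidAlgebra k D)
  let f := (dualEquiv k D).symm (Pi.single 1 1)
  refine ⟨SmashProduct.unitHom M c, SmashProduct.incl M f, fun h => ?_⟩
  rw [SmashProduct.incl_mul_unitHom, SmashProduct.unitHom_apply, SmashProduct.incl_apply,
    SmashProduct.mk_single_mul_mk, one_mul, mul_one] at h
  have h1 := congrArg (tensorCoeff k (DualAlg k (MonoidAlgebra k D)) c) h
  have h2 (b : DualAlg k (MonoidAlgebra k D)) : tensorCoeff k (DualAlg k (MonoidAlgebra k D)) c
      (SmashProduct.mk M b (MonoidAlgebra.single c 1)) = b := by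
    refine (tensorCoeff_tmul_single c c b).trans ?_
    simp
  erw [h2, h2] at h1
  have h3 := congrFun (congrArg (dualEquiv k D) h1) 1
  rw [dualEquiv_harpoon] at h3
  simp [f, hc] at h3

/-- In characteristic `p` the polynomial `x ^ p - x` splits with roots the `p` elements of the
prime field, so `k[x]/(x ^ p - x)` is the algebra of functions on `ℤ/p`. -/
lemma exists_baseAlg_equiv (k : Type*) [Field k] (p : ℕ) [Fact p.Prime] [CharP k p] :
    Nonempty (BaseAlg k p ≃ₐ[k] (ZMod p → k)) := by
  have hp : p.Prime := Fact.out
  let P : Polynomial k := Polynomial.X ^ p - Polynomial.X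
  have hdeg : P.natDegree = p := FiniteField.X_pow_card_sub_X_natDegree_eq k hp.one_lt
  have hP0 : P ≠ 0 := FiniteField.X_pow_card_sub_X_ne_zero k hp.one_lt
  let x : ZMod p → k := fun i => ZMod.castHom (dvd_refl p) k i
  have hx : Function.Injective x := (ZMod.castHom (dvd_refl p) k).injective
  have hroot : Polynomial.aeval x P = 0 := by
    ext i
    have : x i ^ p = x i := by simp only [x, ← map_pow, ZMod.pow_card]
    simp [P, this]
  let Ψ : BaseAlg k p →ₐ[k] (ZMod p → k) := AdjoinRoot.liftAlgHom P (Algebra.ofId k _) x hroot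
  have hΨ (q : Polynomial k) (i : ZMod p) : Ψ (AdjoinRoot.mk P q) i = q.eval (x i) := by
    have h1 : Ψ (AdjoinRoot.mk P q) = Polynomial.aeval x q := AdjoinRoot.lift_mk hroot q
    rw [h1, Polynomial.aeval_pi_apply]
    simp
  have hsurj : Function.Surjective Ψ := fun f =>
    ⟨AdjoinRoot.mk P (Lagrange.interpolate Finset.univ x f), funext fun i => by
      rw [hΨ, Lagrange.eval_interpolate_at_node f hx.injOn (Finset.mem_univ i)]⟩
  have hfin : Module.finrank k (BaseAlg k p) = Module.finrank k (ZMod p → k) := by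
    rw [PowerBasis.finrank (AdjoinRoot.powerBasis hP0)]
    simp [hdeg, ZMod.card]
  have : FiniteDimensional k (BaseAlg k p) := (AdjoinRoot.powerBasis hP0).finite
  exact ⟨AlgEquiv.ofBijective Ψ ⟨(LinearMap.injective_iff_surjective_of_finrank_eq_finrank hfin
    (f := Ψ.toLinearMap)).2 hsurj, hsurj⟩⟩

/-! ### The classification -/

namespace ExtData

section Classification

variable {k A B : Type*} [Field k] [Ring A] [Algebra k A] [Ring B] [Algebra k B]

/-- A homomorphism `φ : A' → B` and a commuting group of units `v : G → Bˣ` give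
`A' ⊗ k[G] → B`. -/
def liftTensor {A' G : Type*} [Ring A'] [Algebra k A'] [Group G] (φ : A' →ₐ[k] B) (v : G →* Bˣ)
    (h : ∀ g a, Commute (v g : B) (φ a)) : A' ⊗[k] MonoidAlgebra k G →ₐ[k] B :=
  Algebra.TensorProduct.lift φ (MonoidAlgebra.lift k B G ((Units.coeHom B).comp v)) fun a x => by
    induction x using MonoidAlgebra.induction_linear with
    | zero => simp
    | add x y hx hy => rw [map_add]; exact hx.add_right hy
    | single g r =>
      rw [MonoidAlgebra.lift_single]
      exact (h g a).symm.smul_right r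

lemma liftTensor_tmul_single {A' G : Type*} [Ring A'] [Algebra k A'] [Group G] (φ : A' →ₐ[k] B)
    (v : G →* Bˣ) (h : ∀ g a, Commute (v g : B) (φ a)) (a : A') (g : G) :
    liftTensor φ v h (a ⊗ₜ[k] MonoidAlgebra.single g (1 : k)) = φ a * v g := by
  simp [liftTensor]

lemma liftTensor_tmul_one {A' G : Type*} [Ring A'] [Algebra k A'] [Group G] (φ : A' →ₐ[k] B)
    (v : G →* Bˣ) (h : ∀ g a, Commute (v g : B) (φ a)) (a : A') :
    liftTensor φ v h (a ⊗ₜ[k] (1 : MonoidAlgebra k G)) = φ a := by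
  simp [liftTensor]

lemma twistEquiv_tensor_of_lift {G : Type*} [Group G] [Finite G]
    {E : ExtData k A (MonoidAlgebra k G) B} (hE : E.IsCleft) (v : G →* Bˣ)
    (hv : ∀ g, E.IsHomog g (v g : B)) (hcomm : ∀ g a, Commute (v g : B) (E.incl a)) :
    E.TwistEquiv (ExtData.tensor k A (MonoidAlgebra k G)) := by
  refine hE.twistEquiv_of_morphism isCleft_tensor AlgEquiv.refl (liftTensor E.incl v hcomm)
    (liftTensor_tmul_one E.incl v hcomm) fun g => ⟨tensorUnitHom k A G g,
      isHomog_tensorUnitHom g, ?_⟩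
  rw [tensorUnitHom_apply, liftTensor_tmul_single, map_one, one_mul]
  exact hv g

lemma twistEquiv_heisenberg_of_lift {G : Type*} [Group G] [Finite G]
    {E : ExtData k (DualAlg k (MonoidAlgebra k G)) (MonoidAlgebra k G) B} (hE : E.IsCleft)
    (v : G →* Bˣ) (hv : ∀ g, E.IsHomog g (v g : B))
    (ψ : DualAlg k (MonoidAlgebra k G) ≃ₐ[k] DualAlg k (MonoidAlgebra k G))
    (hψ : ∀ g a, v g * E.incl (ψ.symm a) = E.incl (ψ.symm
      ((harpoon k (MonoidAlgebra k G)).act (MonoidAlgebra.single g 1) a)) * v g) :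
    E.TwistEquiv (heisenberg k (MonoidAlgebra k G)) := by
  let φ : DualAlg k (MonoidAlgebra k G) →ₐ[k] B := E.incl.comp (ψ.symm : _ →ₐ[k] _)
  let F := SmashProduct.lift φ ((Units.coeHom B).comp v) hψ
  refine hE.twistEquiv_of_morphism (isCleft_smash _) ψ.symm F
    (SmashProduct.lift_incl φ _ hψ) fun g => ⟨SmashProduct.unitHom _ g, isHomog_unitHom _ g, ?_⟩
  rw [show F _ = v g from SmashProduct.lift_unitHom φ _ hψ g]
  exact hv g

lemma twistEquiv_heisenbergTensor_of_lift {G : Type*} [CommGroup G] [Finite G]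
    {E : ExtData k A (MonoidAlgebra k G) B} (hE : E.IsCleft) {C K : Subgroup G} (hCK : IsCompl C K)
    (v : C →* Bˣ) (w : K →* Bˣ) (hv : ∀ c : C, E.IsHomog (c : G) (v c : B))
    (hw : ∀ g : K, E.IsHomog (g : G) (w g : B)) (hwcomm : ∀ g a, Commute (w g : B) (E.incl a))
    (hvw : ∀ c g, Commute (v c) (w g))
    (ψ : A ≃ₐ[k] DualAlg k (MonoidAlgebra k C))
    (hψ : ∀ c a, v c * E.incl (ψ.symm a) = E.incl (ψ.symm
      ((harpoon k (MonoidAlgebra k C)).act (MonoidAlgebra.single c 1) a)) * v c)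
    (ι : A ≃ₐ[k] DualAlg k (MonoidAlgebra k C)) : E.TwistEquiv (heisenbergTensor k C K ι) := by
  let φ : DualAlg k (MonoidAlgebra k C) →ₐ[k] B := E.incl.comp (ψ.symm : _ →ₐ[k] _)
  let F := SmashProduct.lift φ ((Units.coeHom B).comp v) hψ
  have hF (g : K) (x : HeisenbergDouble k (MonoidAlgebra k C)) : Commute (w g : B) (F x) := by
    induction SmashProduct.span_mk _ x using Submodule.span_induction with
    | zero => simp
    | add x y _ _ hx hy => rw [map_add]; exact hx.add_right hy
    | smul r x _ hx => rw [map_smul]; exact hx.smul_right r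
    | mem x hx =>
      obtain ⟨a, c, rfl⟩ := hx
      rw [show F _ = φ a * v c from SmashProduct.lift_mk φ _ hψ a c]
      exact (hwcomm g _).mul_right (congrArg Units.val (hvw c g).symm)
  obtain ⟨f, hf⟩ := exists_mulEquiv_of_isCompl hCK
  have hf' (g : G) : ((f.symm g).1 * (f.symm g).2 : G) = g := by rw [← hf, f.apply_symm_apply]
  refine hE.twistEquiv_of_morphism (isCleft_heisenbergTensor ι hCK) (ι.trans ψ.symm)
    (liftTensor F w hF) (fun a => ?_) fun g => ⟨heisenbergTensorUnitHom k (f.symm g), ?_, ?_⟩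
  · rw [heisenbergTensor_incl, liftTensor_tmul_one]
    exact SmashProduct.lift_incl φ _ hψ _
  · simpa [hf'] using isHomog_heisenbergTensorUnitHom ι (f.symm g)
  · rw [heisenbergTensorUnitHom_apply, liftTensor_tmul_single,
      show F _ = v (f.symm g).1 from SmashProduct.lift_unitHom φ _ hψ _]
    simpa [hf'] using (hv (f.symm g).1).mul (hw (f.symm g).2)

end Classification

section Dichotomy

variable {k A B G X : Type*} [Field k] [IsAlgClosed k] [Ring A] [Algebra k A] [Ring B]
  [Algebra k B] [CommGroup G] [Finite G] {E : ExtData k A (MonoidAlgebra k G) B}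
  (hE : E.IsCleft) (e : A ≃ₐ[k] (X → k)) {p : ℕ} [Fact p.Prime] [CharP k p]
  (hX : Nat.card X = p) (hG : ∀ g : G, g ^ p = 1)
include hE e hX hG

/-- An extension is of the first kind, or the kernel `K` of the action of `G` on `A` has index `p`
and is the stabilizer of a point. -/
lemma twistEquiv_tensor_or_exists_kernel :
    E.TwistEquiv (ExtData.tensor k A (MonoidAlgebra k G)) ∨
    ∃ (α : G →* (A →ₐ[k] A)) (K : Subgroup G) (x₀ : A →ₐ[k] k),
      (∀ g b a, E.IsHomog g b → b * E.incl a = E.incl (α g a) * b) ∧ K.index = p ∧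
      (∀ g ∈ K, ∀ a, α g a = a) ∧ ∀ g, (∀ a, x₀ (α g a) = x₀ a) → g ∈ K := by
  obtain ⟨α, hα⟩ := hE.exists_action (mul_comm_of_equiv_pi e)
  rcases action_dichotomy e p hX hG α with h | ⟨K, x₀, h1, h2, h3⟩
  · obtain ⟨v, hv⟩ := exists_lift_of_trivial hE hα e hG ⊤ fun g _ => h g
    refine .inl (twistEquiv_tensor_of_lift hE (v.comp Subgroup.topEquiv.symm.toMonoidHom)
      (fun g => (hv _).1) fun g a => ?_)
    have := hα g _ a (hv (Subgroup.topEquiv.symm g)).1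
    rw [h] at this
    exact this
  · exact .inr ⟨α, K, x₀, hα, h1, h2, h3⟩

lemma twistEquiv_tensor_or_heisenbergTensor :
    E.TwistEquiv (ExtData.tensor k A (MonoidAlgebra k G)) ∨
    ∃ C K : Subgroup G, IsCompl C K ∧ Nonempty (C ≃* Multiplicative (ZMod p)) ∧
      ∀ ι : A ≃ₐ[k] DualAlg k (MonoidAlgebra k C), E.TwistEquiv (heisenbergTensor k C K ι) := by
  have hp : p.Prime := Fact.out
  have : Finite X := Nat.finite_of_card_ne_zero (hX ▸ hp.ne_zero)
  refine (twistEquiv_tensor_or_exists_kernel hE e hX hG).imp_right ?_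
  rintro ⟨α, K, x₀, hα, hKp, hK, hx₀⟩
  obtain ⟨c, hc⟩ : ∃ c, c ∉ K := by
    by_contra! h
    rw [(Subgroup.eq_top_iff' K).2 h, Subgroup.index_top] at hKp
    exact hp.one_lt.ne hKp
  have hcard : Nat.card (Subgroup.zpowers c) = p := by
    rw [Nat.card_zpowers]
    exact orderOf_eq_prime (hG c) fun h => hc (h ▸ K.one_mem)
  have hdisj : Disjoint (Subgroup.zpowers c) K := by
    have : Fact (Nat.card (Subgroup.zpowers c)).Prime := ⟨hcard ▸ hp⟩
    rcases (K.subgroupOf (Subgroup.zpowers c)).eq_bot_or_eq_top_of_prime_card with h | h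
    · exact (Subgroup.subgroupOf_eq_bot.1 h).symm
    · exact absurd (Subgroup.subgroupOf_eq_top.1 h (Subgroup.mem_zpowers c)) hc
  have hcompl : IsCompl (Subgroup.zpowers c) K :=
    (Subgroup.isComplement'_of_card_mul_and_disjoint (by
      rw [hcard, ← hKp, mul_comm, K.card_mul_index]) hdisj).isCompl
  obtain ⟨w, hw⟩ := exists_lift_of_trivial hE hα e hG K hK
  obtain ⟨v, ψ, hv, hψ⟩ := exists_lift_of_transitive hE hα e hX hG hcard
    (Subgroup.zpowers c).subtype x₀
    fun d hd => Subtype.ext (Subgroup.disjoint_def.1 hdisj d.2 (hx₀ _ hd))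
  refine ⟨Subgroup.zpowers c, K, hcompl, ?_, fun ι =>
    twistEquiv_heisenbergTensor_of_lift hE hcompl v w hv (fun g => (hw g).1) (fun g a => ?_)
      (fun d g => commute_of_pow_eq_one hE hα e (hK g g.2) (hw g).1 (hv d) (hw g).2) ψ
      (fun d a => ?_) ι⟩
  · exact ⟨mulEquivOfPrimeCardEq (p := p) hcard (by simp)⟩
  · have := hα g _ a (hw g).1
    rwa [hK g g.2] at this
  · rw [hα _ _ _ (hv d)]
    congr 2
    apply ψ.injective
    rw [hψ, ψ.apply_symm_apply, ψ.apply_symm_apply]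

end Dichotomy

lemma twistEquiv_tensor_or_heisenberg {k B G : Type*} [Field k] [IsAlgClosed k] [Ring B]
    [Algebra k B] [CommGroup G] [Finite G] {p : ℕ} [Fact p.Prime] [CharP k p]
    (hG : ∀ g : G, g ^ p = 1) (hcard : Nat.card G = p)
    {E : ExtData k (DualAlg k (MonoidAlgebra k G)) (MonoidAlgebra k G) B} (hE : E.IsCleft) :
    E.TwistEquiv (ExtData.tensor k (DualAlg k (MonoidAlgebra k G)) (MonoidAlgebra k G)) ∨
      E.TwistEquiv (heisenberg k (MonoidAlgebra k G)) := by
  refine (twistEquiv_tensor_or_exists_kernel hE (dualEquiv k G) hcard hG).imp_right ?_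
  rintro ⟨α, K, x₀, hα, hKp, hK, hx₀⟩
  have hbot : K = ⊥ := by
    rw [← Subgroup.card_eq_one]
    have := K.card_mul_index
    rw [hKp, hcard] at this
    exact Nat.eq_of_mul_eq_mul_right (Fact.out : p.Prime).pos (this.trans (one_mul p).symm)
  obtain ⟨v, ψ, hv, hψ⟩ := exists_lift_of_transitive hE hα (dualEquiv k G) hcard hG hcard
    (MonoidHom.id G) x₀ fun d hd => by simpa [hbot] using hx₀ d hd
  refine twistEquiv_heisenberg_of_lift hE v hv ψ fun g a => ?_
  rw [hα _ _ _ (hv g)]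
  congr 2
  apply ψ.injective
  rw [ψ.apply_symm_apply]
  exact (hψ g _).trans (by rw [ψ.apply_symm_apply])

end ExtData

lemma tensor_mul_comm {k A G : Type*} [Field k] [Ring A] [Algebra k A] [CommGroup G]
    (hA : ∀ a b : A, a * b = b * a) (x y : A ⊗[k] MonoidAlgebra k G) : x * y = y * x := by
  induction x with
  | zero => simp
  | add x x' hx hx' => rw [add_mul, mul_add, hx, hx']
  | tmul a g =>
    induction y with
    | zero => simp
    | add y y' hy hy' => rw [add_mul, mul_add, hy, hy']
    | tmul b h => simp [hA a b, mul_comm g h]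

lemma heisenberg_tensor_not_comm {k C K : Type*} [Field k] [Group C] [Group K] [Nontrivial C] :
    ∃ x y : HeisenbergDouble k (MonoidAlgebra k C) ⊗[k] MonoidAlgebra k K, x * y ≠ y * x := by
  obtain ⟨x, y, hxy⟩ := heisenberg_not_comm (k := k) (D := C)
  have h1 : Function.Injective (Algebra.TensorProduct.includeLeft :
        HeisenbergDouble k (MonoidAlgebra k C) →ₐ[k] _ ⊗[k] MonoidAlgebra k K) :=
      Algebra.TensorProduct.includeLeft_injective
        (FaithfulSMul.algebraMap_injective k (MonoidAlgebra k K))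
  refine ⟨Algebra.TensorProduct.includeLeft (S := k) x,
    Algebra.TensorProduct.includeLeft (S := k) y, fun h => hxy (h1 ?_)⟩
  rw [map_mul, map_mul, h]

lemma exists_baseAlg_equiv_dual (k : Type*) [Field k] (p : ℕ) [Fact p.Prime] [CharP k p]
    {C : Type*} [Group C] (f : C ≃* Multiplicative (ZMod p)) :
    Nonempty (BaseAlg k p ≃ₐ[k] DualAlg k (MonoidAlgebra k C)) := by
  obtain ⟨e⟩ := exists_baseAlg_equiv k p
  exact ⟨e.trans ((AlgEquiv.piCongrLeft k (fun _ => k)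
    (f.toEquiv.trans Multiplicative.toAdd)).symm.trans (dualEquiv k C).symm)⟩

end CleftExt

end

theorem mainTheorem11 {k : Type*} [Field k] [IsAlgClosed k] (p : ℕ) [Fact p.Prime] [CharP k p]
    (G : Type*) [CommGroup G] [Finite G] (hG : ∀ g : G, g ^ p = 1) :
    -- every cleft extension of `k[x]/(x^p - x)` is twist equivalent to one of the models
    (∀ (B : Type*) [Ring B] [Algebra k B]
        (E : CleftExt.ExtData k (CleftExt.BaseAlg k p) (MonoidAlgebra k G) B), E.IsCleft →
      E.TwistEquiv (CleftExt.ExtData.tensor k (CleftExt.BaseAlg k p) (MonoidAlgebra k G)) ∨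
      ∃ C G' : Subgroup G, IsCompl C G' ∧ Nonempty (C ≃* Multiplicative (ZMod p)) ∧
        ∀ ι : CleftExt.BaseAlg k p ≃ₐ[k] CleftExt.DualAlg k (MonoidAlgebra k C),
          E.TwistEquiv (CleftExt.ExtData.heisenbergTensor k C G' ι)) ∧
    -- the models are cleft extensions, and the two kinds are not twist equivalent
    (CleftExt.ExtData.tensor k (CleftExt.BaseAlg k p) (MonoidAlgebra k G)).IsCleft ∧
    (∀ C G' : Subgroup G, IsCompl C G' → Nonempty (C ≃* Multiplicative (ZMod p)) →
      Nonempty (CleftExt.BaseAlg k p ≃ₐ[k] CleftExt.DualAlg k (MonoidAlgebra k C)) ∧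
      ∀ ι : CleftExt.BaseAlg k p ≃ₐ[k] CleftExt.DualAlg k (MonoidAlgebra k C),
        (CleftExt.ExtData.heisenbergTensor k C G' ι).IsCleft ∧
        ¬ (CleftExt.ExtData.tensor k (CleftExt.BaseAlg k p) (MonoidAlgebra k G)).TwistEquiv
          (CleftExt.ExtData.heisenbergTensor k C G' ι)) ∧
    -- the case `G = C_p`
    (Nonempty (G ≃* Multiplicative (ZMod p)) →
      (∀ (B : Type*) [Ring B] [Algebra k B]
          (E : CleftExt.ExtData k (CleftExt.DualAlg k (MonoidAlgebra k G)) (MonoidAlgebra k G) B),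
        E.IsCleft →
          E.TwistEquiv (CleftExt.ExtData.tensor k (CleftExt.DualAlg k (MonoidAlgebra k G))
            (MonoidAlgebra k G)) ∨
          E.TwistEquiv (CleftExt.ExtData.heisenberg k (MonoidAlgebra k G))) ∧
      (CleftExt.ExtData.tensor k (CleftExt.DualAlg k (MonoidAlgebra k G))
        (MonoidAlgebra k G)).IsCleft ∧
      (CleftExt.ExtData.heisenberg k (MonoidAlgebra k G)).IsCleft ∧
      ¬ (CleftExt.ExtData.tensor k (CleftExt.DualAlg k (MonoidAlgebra k G))
          (MonoidAlgebra k G)).TwistEquiv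
        (CleftExt.ExtData.heisenberg k (MonoidAlgebra k G))) := by
  obtain ⟨e⟩ := CleftExt.exists_baseAlg_equiv k p
  have hp : p.Prime := Fact.out
  have hcardZ : Nat.card (ZMod p) = p := by simp
  have hnt (C : Type _) [Group C] (h : Nonempty (C ≃* Multiplicative (ZMod p))) :
      Nontrivial C := by
    obtain ⟨f⟩ := h
    exact f.toEquiv.nontrivial
  refine ⟨fun B _ _ E hE => ?_, CleftExt.ExtData.isCleft_tensor, fun C G' hCG hC => ⟨?_, fun ι =>
    ⟨CleftExt.ExtData.isCleft_heisenbergTensor ι hCG, fun h => ?_⟩⟩, fun hGp => ⟨?_, ?_, ?_, ?_⟩⟩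
  · exact CleftExt.ExtData.twistEquiv_tensor_or_heisenbergTensor hE e hcardZ hG
  · exact hC.elim (CleftExt.exists_baseAlg_equiv_dual k p)
  · have := hnt C hC
    obtain ⟨x, y, hxy⟩ := CleftExt.heisenberg_tensor_not_comm (k := k) (C := C) (K := G')
    exact hxy (h.mul_comm
      (CleftExt.tensor_mul_comm (CleftExt.mul_comm_of_equiv_pi e)) x y)
  · intro B _ _ E hE
    have hcard : Nat.card G = p := by
      rw [Nat.card_congr hGp.some.toEquiv]
      simp
    exact CleftExt.ExtData.twistEquiv_tensor_or_heisenberg hG hcard hE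
  · exact CleftExt.ExtData.isCleft_tensor
  · exact CleftExt.ExtData.isCleft_smash _
  · intro h
    have := hnt G hGp
    obtain ⟨x, y, hxy⟩ := CleftExt.heisenberg_not_comm (k := k) (D := G)
    exact hxy (h.mul_comm (CleftExt.tensor_mul_comm
      (CleftExt.mul_comm_of_equiv_pi (CleftExt.dualEquiv k G))) x y)
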